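/- All manifolds are connected, second countable, Hausdorff, smooth ($C^\infty$), finite-dimensional and without boundary. For a manifold $M$, let $\tau\colon TM\to M$ be the tangent bundle, $\mathring{T}M\subset TM$ the set of nonzero tangent vectors, $C$ the Liouville vector field on $TM$ and $\mathbf J$ the vertical endomorphism of $TTM$ (that is, $\mathbf J\xi$ is the vertical lift of $\tau_*\xi$ to the base point of $\xi$ in $TM$). A *Finsler function* on $M$ is a continuous function $F\colon TM\to\mathbb R$ that is smooth on $\mathring{T}M$, positive on $\mathring{T}M$, satisfies $F(tv)=tF(v)$ for all $t>0$, $v\in TM$, and is elliptic: for every $p\in M$ and every nonzero $v\in T_pM$ the second derivative at $v$ of $F^2|_{T_pM}$ is positive definite. The pair $(M,F)$ is then a *Finsler manifold*, with energy $E=\frac12F^2$. A *spray* is a section $S\colon TM\to TTM$ that is smooth on $\mathring{T}M$, positive-homogeneous of degree $2$ (that is, $S(tv)=t\,(\mu_t)_*S(v)$ for $t>0$, where $\mu_t(v)=tv$), and satisfies $\mathbf JS=C$. The *canonical spray* of $(M,F)$ is the unique spray $S$ with $i_Sd(dE\circ\mathbf J)=-dE$ on $\mathring{T}M$. A *geodesic*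 of $(M,F)$ is a smooth curve $\gamma\colon I\to M$ on a nondegenerate interval $I\subset\mathbb R$ whose velocity field $\dot\gamma\colon I\to TM$ is an integral curve of the canonical spray, $S\circ\dot\gamma=\ddot\gamma$. Let $(M,F)$ and $(N,\bar F)$ be (possibly different) Finsler manifolds. A *Finslerian isometry* is a diffeomorphism $\varphi\colon M\to N$ with $\bar F\circ\varphi_*=F$. A *local Finslerian isometry* is a map $\varphi\colon M\to N$ such that every point of $M$ has an open neighbourhood $U$ that $\varphi$ maps diffeomorphically onto an open subset of $N$, with $\bar F\circ\varphi_*=F$ on $TU$. **Proposition.** Let $\varphi\colon M\to N$ be a Finslerian isometry or a local Finslerian isometry. If $\gamma\colon I\to M$ is a geodesic of $(M,F)$, then $\varphi\circ\gamma\colon I\to N$ is a geodesic of $(N,\bar F)$. Moreover, the canonical sprays $S$ of $(M,F)$ and $\bar S$ of $(N,\bar F)$ satisfy $\varphi_{**}\circ S=\bar S\circ\varphi_*$ on $TM$. -/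

import Mathlib

open scoped Manifold ContDiff Topology

noncomputable section

namespace FinslerGeometry

section ExteriorDerivative

variable {V : Type*} [NormedAddCommGroup V] [NormedSpace ℝ V]
  {H : Type*} [TopologicalSpace H] (J : ModelWithCorners ℝ V H)
  {Q : Type*} [TopologicalSpace Q] [ChartedSpace H Q]

/-- The coordinate expression, in the preferred chart at `x`, of a 1-form `θ` on a manifold `Q`
without boundary: the pull-back of `θ` by the inverse of the chart. -/
def oneFormInChart (θ : ∀ y : Q, TangentSpace J y →L[ℝ] ℝ) (x : Q) (z : V) : V →L[ℝ] ℝ :=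
  (θ ((extChartAt J x).symm z)).comp (mfderiv 𝓘(ℝ, V) J (extChartAt J x).symm z)

/-- The exterior derivative `(dθ)ₓ(ξ, η)` of a 1-form `θ` on a manifold without boundary, computed
in the preferred chart at `x`, with the convention `dθ(X, Y) = X θ(Y) - Y θ(X) - θ([X, Y])`. -/
def oneFormExtDeriv (θ : ∀ y : Q, TangentSpace J y →L[ℝ] ℝ) (x : Q)
    (ξ η : TangentSpace J x) : ℝ :=
  let D := fderiv ℝ (oneFormInChart J θ x) (extChartAt J x x)
  let ξ' : V := mfderiv J 𝓘(ℝ, V) (extChartAt J x) x ξ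
  let η' : V := mfderiv J 𝓘(ℝ, V) (extChartAt J x) x η
  D ξ' η' - D η' ξ'

end ExteriorDerivative

variable {E : Type*} [NormedAddCommGroup E] [NormedSpace ℝ E]
  {M : Type*} [TopologicalSpace M] [ChartedSpace E M]

section Basic

variable (E M) in
/-- The set of nonzero tangent vectors of `M`. -/
def slit : Set (TangentBundle 𝓘(ℝ, E) M) := {v | v.2 ≠ 0}

/-- The dilation `v ↦ t v` of the tangent bundle. -/
def dilation (t : ℝ) (v : TangentBundle 𝓘(ℝ, E) M) : TangentBundle 𝓘(ℝ, E) M :=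
  ⟨v.1, t • v.2⟩

/-- The fibre inclusion `T_pM → TM`, where `T_pM` is the vector space `E`. -/
def fiberIncl (p : M) (u : E) : TangentBundle 𝓘(ℝ, E) M := ⟨p, u⟩

/-- The energy function `E = F² / 2`. -/
def energy (F : TangentBundle 𝓘(ℝ, E) M → ℝ) (v : TangentBundle 𝓘(ℝ, E) M) : ℝ :=
  (1 / 2) * F v ^ 2

/-- `F_p²` as a function on the vector space `T_pM = E`. -/
def fiberSq (F : TangentBundle 𝓘(ℝ, E) M → ℝ) (p : M) (u : E) : ℝ := F (fiberIncl p u) ^ 2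

end Basic

variable [IsManifold 𝓘(ℝ, E) ∞ M]

/-- Finsler functions: continuous on `TM`, smooth on the nonzero vectors, positive-homogeneous of
degree 1, positive on the nonzero vectors, and elliptic. -/
structure IsFinslerFunction (F : TangentBundle 𝓘(ℝ, E) M → ℝ) : Prop where
  continuous : Continuous F
  smooth : ContMDiffOn 𝓘(ℝ, E).tangent 𝓘(ℝ, ℝ) ∞ F (slit E M)
  homogeneous : ∀ (t : ℝ) (v : TangentBundle 𝓘(ℝ, E) M), 0 < t → F (dilation t v) = t * F v
  pos : ∀ v ∈ slit E M, 0 < F v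
  elliptic : ∀ (p : M) (v w : E), v ≠ 0 → w ≠ 0 →
    0 < fderiv ℝ (fderiv ℝ (fiberSq F p)) v w w

/-- The vertical lift at `v ∈ TM` of a vector of `T_{π(v)}M`: the derivative at `v` of the inclusion
of the fibre. -/
def vlift (v : TangentBundle 𝓘(ℝ, E) M) :
    TangentSpace 𝓘(ℝ, E) v.1 →L[ℝ] TangentSpace 𝓘(ℝ, E).tangent v :=
  mfderiv 𝓘(ℝ, E) 𝓘(ℝ, E).tangent (fun u : E => (fiberIncl v.1 u : TangentBundle 𝓘(ℝ, E) M))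
    (v.2 : E)

/-- The vertical endomorphism `𝐉` at `v`: project to `TM`, then lift vertically. -/
def vertEndo (v : TangentBundle 𝓘(ℝ, E) M) :
    TangentSpace 𝓘(ℝ, E).tangent v →L[ℝ] TangentSpace 𝓘(ℝ, E).tangent v :=
  (vlift v).comp (mfderiv 𝓘(ℝ, E).tangent 𝓘(ℝ, E)
    (fun w : TangentBundle 𝓘(ℝ, E) M => w.1) v)

/-- The Liouville vector field `C`. -/
def liouville (v : TangentBundle 𝓘(ℝ, E) M) : TangentSpace 𝓘(ℝ, E).tangent v := vlift v v.2

/-- The differential of a real function on `TM`. -/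
def diff (f : TangentBundle 𝓘(ℝ, E) M → ℝ) (v : TangentBundle 𝓘(ℝ, E) M) :
    TangentSpace 𝓘(ℝ, E).tangent v →L[ℝ] ℝ :=
  mfderiv 𝓘(ℝ, E).tangent 𝓘(ℝ, ℝ) f v

/-- Sprays: sections of `TTM → TM`, smooth on the nonzero vectors, positive-homogeneous of
degree 2, with `𝐉 S = C`. -/
structure IsSpray
    (S : ∀ v : TangentBundle 𝓘(ℝ, E) M, TangentSpace 𝓘(ℝ, E).tangent v) : Prop where
  smooth : ContMDiffOn 𝓘(ℝ, E).tangent 𝓘(ℝ, E).tangent.tangent ∞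
    (fun v => (⟨v, S v⟩ : TangentBundle 𝓘(ℝ, E).tangent (TangentBundle 𝓘(ℝ, E) M))) (slit E M)
  homogeneous : ∀ (t : ℝ) (v : TangentBundle 𝓘(ℝ, E) M), 0 < t →
    S (dilation t v) =
      t • mfderiv 𝓘(ℝ, E).tangent 𝓘(ℝ, E).tangent (dilation (M := M) t) v (S v)
  vertEndo_eq : ∀ v, vertEndo v (S v) = liouville v

/-- `S` is the canonical spray of `F`: it is a spray and `i_S d(dE ∘ 𝐉) = -dE` on the nonzero
vectors, where `E` is the energy. -/
structure IsCanonicalSpray (F : TangentBundle 𝓘(ℝ, E) M → ℝ)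
    (S : ∀ v : TangentBundle 𝓘(ℝ, E) M, TangentSpace 𝓘(ℝ, E).tangent v) : Prop where
  isSpray : IsSpray S
  eq : ∀ v ∈ slit E M, ∀ η : TangentSpace 𝓘(ℝ, E).tangent v,
    oneFormExtDeriv 𝓘(ℝ, E).tangent (fun w => (diff (energy F) w).comp (vertEndo w)) v (S v) η
      = - diff (energy F) v η

/-- The velocity field of a curve `γ` defined on an interval `s` (with one-sided derivatives at end
points that belong to `s`). -/
def velocity (γ : ℝ → M) (s : Set ℝ) (t : ℝ) : TangentBundle 𝓘(ℝ, E) M :=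
  ⟨γ t, mfderivWithin 𝓘(ℝ, ℝ) 𝓘(ℝ, E) γ s t (1 : ℝ)⟩

/-- `γ : s → M` is a geodesic of the spray `S`: it is smooth and its velocity field is an integral
curve of `S`. The values of `γ` outside `s` are irrelevant. -/
def IsSprayGeodesic (S : ∀ v : TangentBundle 𝓘(ℝ, E) M, TangentSpace 𝓘(ℝ, E).tangent v)
    (γ : ℝ → M) (s : Set ℝ) : Prop :=
  ContMDiffOn 𝓘(ℝ, ℝ) 𝓘(ℝ, E) ∞ γ s ∧ IsMIntegralCurveOn (velocity γ s) S s

/-- `γ : s → M` is a geodesic of the Finsler function `F`: it is a geodesic of the canonical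
spray. -/
def IsFinslerGeodesic (F : TangentBundle 𝓘(ℝ, E) M → ℝ) (γ : ℝ → M) (s : Set ℝ) : Prop :=
  ∃ S, IsCanonicalSpray F S ∧ IsSprayGeodesic S γ s

variable {E' : Type*} [NormedAddCommGroup E'] [NormedSpace ℝ E']
  {N : Type*} [TopologicalSpace N] [ChartedSpace E' N] [IsManifold 𝓘(ℝ, E') ∞ N]

/-- Finslerian isometries: diffeomorphisms whose derivative preserves the Finsler functions. -/
def IsFinslerIsometry (F : TangentBundle 𝓘(ℝ, E) M → ℝ) (F' : TangentBundle 𝓘(ℝ, E') N → ℝ)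
    (φ : M → N) : Prop :=
  (∃ Φ : M ≃ₘ^∞⟮𝓘(ℝ, E), 𝓘(ℝ, E')⟯ N, φ = Φ) ∧
    ∀ v, F' (tangentMap 𝓘(ℝ, E) 𝓘(ℝ, E') φ v) = F v

/-- Local Finslerian isometries: every point has an open neighbourhood that `φ` maps
diffeomorphically onto an open set, with the derivative preserving the Finsler functions. -/
def IsLocalFinslerIsometry (F : TangentBundle 𝓘(ℝ, E) M → ℝ)
    (F' : TangentBundle 𝓘(ℝ, E') N → ℝ) (φ : M → N) : Prop :=
  ∀ p : M, ∃ Φ : PartialDiffeomorph 𝓘(ℝ, E) 𝓘(ℝ, E') M N ∞,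
    p ∈ Φ.source ∧ Set.EqOn φ Φ Φ.source ∧
      ∀ v : TangentBundle 𝓘(ℝ, E) M, v.1 ∈ Φ.source →
        F' (tangentMap 𝓘(ℝ, E) 𝓘(ℝ, E') φ v) = F v

end FinslerGeometry

end

/-! The canonical spray is built naturally from the energy, so a map preserving the energy carries
one spray to the other; geodesics follow by the chain rule. Locally the argument concerns a
Lagrangian `L` on `E × E`, and `IsSprayVector` is the pointwise equation `i_ξ d(dL ∘ 𝐉) = -dL`
together with `𝐉 ξ = C`.

Naturality (`IsSprayVector.map`): a tangent map `Th` commutes with the vertical endomorphisms, so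
`dL ∘ 𝐉` is the pullback of `dL' ∘ 𝐉` when `L = L' ∘ Th`, and the exterior derivative commutes with
pullback because second derivatives are symmetric. Hence the image of a spray vector is a spray
vector.

Uniqueness (`isSprayVector_iff_eq_sprayModel`): for `L` homogeneous of degree 2 the equation becomes
an Euler-Lagrange system whose leading coefficient is the fibre Hessian. Ellipticity and finite
dimension make that Hessian invertible, so there is exactly one solution, given by an explicit
smooth formula. The image of `S v` must therefore be the value of the spray of `N`. On zero vectors
the equation says nothing, but homogeneity forces both sprays to vanish (`IsSpray.eq_zero`).

`IsFinslerGeodesic` asks for the existence of a canonical spray, so one must also be constructed on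
`N`: the pointwise solutions are glued, and naturality under the identity map, read in two different
charts, shows that they form a smooth section (`IsFinslerFunction.isCanonicalSpray_canonicalSpray`).

Throughout, `TangentSpace` at `v` is `E × E` read in the preferred chart at `v`. Geometric objects
thus take their model form at `v` only in the chart at `v`, and the coordinate changes to other
charts are tangent maps too. -/

noncomputable section

namespace FinslerGeometry

/-! ### Sprays of Lagrangians on a product of vector spaces. -/

section VectorSpace

variable {E : Type*} [NormedAddCommGroup E] [NormedSpace ℝ E]
  {E' : Type*} [NormedAddCommGroup E'] [NormedSpace ℝ E']

variable (E) in
/-- The vertical endomorphism `(a, b) ↦ (0, a)` of `E × E`. -/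
def vertModel : E × E →L[ℝ] E × E :=
  (ContinuousLinearMap.inr ℝ E E).comp (ContinuousLinearMap.fst ℝ E E)

@[simp] lemma vertModel_apply (ξ : E × E) : vertModel E ξ = (0, ξ.1) := rfl

/-- The 1-form `dL ∘ 𝐉` on `E × E`. -/
def vertForm (L : E × E → ℝ) (z : E × E) : E × E →L[ℝ] ℝ := (fderiv ℝ L z).comp (vertModel E)

/-- `ξ` is a value at `z` of the spray of the Lagrangian `L` on `E × E`. -/
structure IsSprayVector (L : E × E → ℝ) (z ξ : E × E) : Prop where
  fst_eq : ξ.1 = z.2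
  eq : ∀ η, fderiv ℝ (vertForm L) z ξ η - fderiv ℝ (vertForm L) z η ξ = - fderiv ℝ L z η

lemma differentiableAt_fderiv_of_contDiffAt {L : E → E'} {z : E} (hL : ContDiffAt ℝ ∞ L z) :
    DifferentiableAt ℝ (fderiv ℝ L) z :=
  (hL.fderiv_right (m := ∞) (by simp)).differentiableAt (by simp)

lemma hasFDerivAt_vertForm {L : E × E → ℝ} {z : E × E} (hL : ContDiffAt ℝ ∞ L z) :
    HasFDerivAt (vertForm L)
      (((ContinuousLinearMap.compL ℝ (E × E) (E × E) ℝ).flip (vertModel E)).comp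
        (fderiv ℝ (fderiv ℝ L) z)) z :=
  ((ContinuousLinearMap.compL ℝ (E × E) (E × E) ℝ).flip (vertModel E)).hasFDerivAt.comp z
    (differentiableAt_fderiv_of_contDiffAt hL).hasFDerivAt

lemma fderiv_vertForm {L : E × E → ℝ} {z : E × E} (hL : ContDiffAt ℝ ∞ L z) (ξ η : E × E) :
    fderiv ℝ (vertForm L) z ξ η = fderiv ℝ (fderiv ℝ L) z ξ (0, η.1) := by
  rw [(hasFDerivAt_vertForm hL).fderiv]; rfl

/-- The tangent map of `h`, as a map of product spaces. -/
def tangentModel (h : E → E') (z : E × E) : E' × E' := (h z.1, fderiv ℝ h z.1 z.2)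

lemma contDiffAt_tangentModel {h : E → E'} {z : E × E} (hh : ContDiffAt ℝ ∞ h z.1) :
    ContDiffAt ℝ ∞ (tangentModel h) z := by
  have h1 : ContDiffAt ℝ ∞ (fderiv ℝ h) z.1 := hh.fderiv_right (by simp)
  exact (hh.comp z contDiffAt_fst).prodMk ((h1.comp z contDiffAt_fst).clm_apply contDiffAt_snd)

lemma hasFDerivAt_tangentModel {h : E → E'} {z : E × E} (hh : ContDiffAt ℝ ∞ h z.1) :
    HasFDerivAt (tangentModel h)
      (((fderiv ℝ h z.1).comp (ContinuousLinearMap.fst ℝ E E)).prod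
        ((fderiv ℝ h z.1).comp (ContinuousLinearMap.snd ℝ E E) +
          (((fderiv ℝ (fderiv ℝ h) z.1).comp (ContinuousLinearMap.fst ℝ E E)).flip z.2))) z := by
  have h1 := (differentiableAt_fderiv_of_contDiffAt hh).hasFDerivAt.comp z hasFDerivAt_fst
  have h0 : HasFDerivAt h (fderiv ℝ h z.1) z.1 := (hh.differentiableAt (by simp)).hasFDerivAt
  exact (h0.comp z hasFDerivAt_fst).prodMk (h1.clm_apply hasFDerivAt_snd)

lemma fderiv_tangentModel {h : E → E'} {z : E × E} (hh : ContDiffAt ℝ ∞ h z.1) (ξ : E × E) :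
    fderiv ℝ (tangentModel h) z ξ =
      (fderiv ℝ h z.1 ξ.1, fderiv ℝ h z.1 ξ.2 + fderiv ℝ (fderiv ℝ h) z.1 ξ.1 z.2) := by
  rw [(hasFDerivAt_tangentModel hh).fderiv]; rfl

lemma eventually_contDiffAt {f : E → E'} {x : E} (hf : ContDiffAt ℝ ∞ f x) :
    ∀ᶠ y in 𝓝 x, ContDiffAt ℝ 1 f y :=
  (hf.of_le (m := 1) (by exact_mod_cast le_top)).eventually (by simp)

/-- The derivative of a tangent map sends `(0, a)` to `(0, Dh a)`, so it commutes with the vertical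
endomorphisms. -/
lemma vertForm_comp_tangentModel {h : E → E'} {L' : E' × E' → ℝ} {z : E × E}
    (hh : ContDiffAt ℝ ∞ h z.1) (hL' : DifferentiableAt ℝ L' (tangentModel h z)) :
    vertForm (L' ∘ tangentModel h) z =
      (vertForm L' (tangentModel h z)).comp (fderiv ℝ (tangentModel h) z) := by
  refine ContinuousLinearMap.ext fun ξ => ?_
  have hg := (contDiffAt_tangentModel hh).differentiableAt (by simp)
  simp [vertForm, fderiv_comp z hL' hg, fderiv_tangentModel hh]

/-- Sprays are mapped to sprays by tangent maps. -/
theorem IsSprayVector.map {h : E → E'} {L : E × E → ℝ} {L' : E' × E' → ℝ} {z ξ : E × E}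
    (hξ : IsSprayVector L z ξ)
    (hh : ∀ᶠ x in 𝓝 z.1, ContDiffAt ℝ ∞ h x) (hL' : ContDiffAt ℝ ∞ L' (tangentModel h z))
    (hL : L =ᶠ[𝓝 z] L' ∘ tangentModel h)
    (hsurj : Function.Surjective (fderiv ℝ (tangentModel h) z)) :
    IsSprayVector L' (tangentModel h z) (fderiv ℝ (tangentModel h) z ξ) := by
  have hh0 := hh.self_of_nhds
  have hg := contDiffAt_tangentModel hh0
  have hgd := hg.differentiableAt (by simp)
  refine ⟨by rw [fderiv_tangentModel hh0, hξ.fst_eq]; rfl, fun η' => ?_⟩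
  -- Surjectivity allows testing the equation on images of vectors upstairs only.
  obtain ⟨η, rfl⟩ := hsurj η'
  have hform : vertForm L =ᶠ[𝓝 z]
      fun w => (vertForm L' (tangentModel h w)).comp (fderiv ℝ (tangentModel h) w) := by
    filter_upwards [hL.eventuallyEq_nhds,
      (continuous_fst.tendsto z).eventually hh,
      hg.continuousAt.eventually (eventually_contDiffAt hL')] with w hw hhw hw'
    rw [← vertForm_comp_tangentModel hhw (hw'.differentiableAt (by simp))]
    simp only [vertForm, hw.fderiv_eq]
  have hd := ((hasFDerivAt_vertForm hL').comp z hgd.hasFDerivAt).clm_comp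
    (differentiableAt_fderiv_of_contDiffAt hg).hasFDerivAt
  -- Product rule for the pulled-back form. The second summand is symmetric in `ξ` and `η`, so it
  -- disappears on antisymmetrising.
  have hkey : ∀ ξ η, fderiv ℝ (vertForm L) z ξ η =
      fderiv ℝ (vertForm L') (tangentModel h z) (fderiv ℝ (tangentModel h) z ξ)
        (fderiv ℝ (tangentModel h) z η) +
      vertForm L' (tangentModel h z) (fderiv ℝ (fderiv ℝ (tangentModel h)) z ξ η) := by
    intro ξ η
    rw [hform.fderiv_eq, (hasFDerivAt_vertForm hL').fderiv]
    erw [hd.fderiv]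
    simp [add_comm]
  have hsymm : IsSymmSndFDerivAt ℝ (tangentModel h) z :=
    hg.isSymmSndFDerivAt (by
      rw [minSmoothness_of_isRCLikeNormedField]
      exact WithTop.coe_le_coe.2 (le_top (a := (2 : ℕ∞))))
  have h1 := hξ.eq η
  rw [hkey, hkey, hsymm.eq ξ η, hL.fderiv_eq,
    fderiv_comp z (hL'.differentiableAt (by simp)) hgd] at h1
  simp only [ContinuousLinearMap.comp_apply] at h1
  linarith

/-- Positive homogeneity of degree 2 in the second variable, near `z`. -/
def HomogeneousNear (L : E × E → ℝ) (z : E × E) : Prop :=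
  ∀ᶠ w in 𝓝 z, ∀ t : ℝ, 0 < t → L (w.1, t • w.2) = t ^ 2 * L w

/-- Euler's relation: differentiate the homogeneity identity in `t` at `t = 1`. -/
lemma fderiv_apply_vertical_self {L : E × E → ℝ} {z : E × E} (hL : DifferentiableAt ℝ L z)
    (hom : ∀ t : ℝ, 0 < t → L (z.1, t • z.2) = t ^ 2 * L z) :
    fderiv ℝ L z (0, z.2) = 2 * L z := by
  have hc : HasDerivAt (fun t : ℝ => (z.1, t • z.2)) ((0 : E), (1 : ℝ) • z.2) 1 :=
    (hasDerivAt_const (1 : ℝ) z.1).prodMk ((hasDerivAt_id (1 : ℝ)).smul_const z.2)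
  have hL' : HasFDerivAt L (fderiv ℝ L z) ((z.1, (1 : ℝ) • z.2) : E × E) := by
    simpa using hL.hasFDerivAt
  have h1 := hL'.comp_hasDerivAt (1 : ℝ) hc
  have h2 : HasDerivAt (fun t : ℝ => t ^ 2 * L z) (2 * L z) 1 := by
    simpa using (hasDerivAt_pow 2 (1 : ℝ)).mul_const (L z)
  have h3 : (L ∘ fun t : ℝ => (z.1, t • z.2)) =ᶠ[𝓝 1] fun t => t ^ 2 * L z := by
    filter_upwards [lt_mem_nhds (zero_lt_one' ℝ)] with t ht using hom t ht
  simpa using h1.unique (h2.congr_of_eventuallyEq h3)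

/-- Derivative of Euler's relation in the direction `η`; this is why homogeneity is required near
`z` and not only at `z`. -/
lemma fderiv_fderiv_apply_vertical_self {L : E × E → ℝ} {z : E × E} (hL : ContDiffAt ℝ ∞ L z)
    (hom : HomogeneousNear L z) (η : E × E) :
    fderiv ℝ (fderiv ℝ L) z η (0, z.2) + fderiv ℝ L z (0, η.2) = 2 * fderiv ℝ L z η := by
  have h1 : (fun w : E × E => fderiv ℝ L w (0, w.2)) =ᶠ[𝓝 z] fun w => 2 * L w := by
    filter_upwards [hom, eventually_contDiffAt hL] with w hw hLw
    exact fderiv_apply_vertical_self (hLw.differentiableAt (by simp)) hw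
  have h2 : HasFDerivAt (fun w : E × E => ((0 : E), w.2))
      ((ContinuousLinearMap.inr ℝ E E).comp (ContinuousLinearMap.snd ℝ E E)) z :=
    ((ContinuousLinearMap.inr ℝ E E).comp (ContinuousLinearMap.snd ℝ E E)).hasFDerivAt
  have h3 := (differentiableAt_fderiv_of_contDiffAt hL).hasFDerivAt.clm_apply h2
  have h4 := (hL.differentiableAt (by simp)).hasFDerivAt.const_mul 2
  have h5 := congrArg (fun A => A η) (h3.unique (h4.congr_of_eventuallyEq h1))
  simpa [add_comm] using h5

/-- The Hessian of `L` in the second variable. -/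
def vertHess (L : E × E → ℝ) (z : E × E) : E →L[ℝ] E →L[ℝ] ℝ :=
  ((ContinuousLinearMap.compL ℝ E (E × E) ℝ).flip (ContinuousLinearMap.inr ℝ E E)).comp
    ((fderiv ℝ (fderiv ℝ L) z).comp (ContinuousLinearMap.inr ℝ E E))

lemma vertHess_apply (L : E × E → ℝ) (z : E × E) (b a : E) :
    vertHess L z b a = fderiv ℝ (fderiv ℝ L) z (0, b) (0, a) := rfl

/-- The inhomogeneous term of the Euler-Lagrange equation. -/
def eulerLagrangeForce (L : E × E → ℝ) (z : E × E) : E →L[ℝ] ℝ :=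
  (fderiv ℝ L z).comp (ContinuousLinearMap.inl ℝ E E) -
    (fderiv ℝ (fderiv ℝ L) z (z.2, 0)).comp (ContinuousLinearMap.inr ℝ E E)

/-- The Euler-Lagrange form of the spray equation. -/
lemma isSprayVector_iff {L : E × E → ℝ} {z : E × E} (hL : ContDiffAt ℝ ∞ L z)
    (hom : HomogeneousNear L z) (ξ : E × E) :
    IsSprayVector L z ξ ↔ ξ.1 = z.2 ∧ vertHess L z ξ.2 = eulerLagrangeForce L z := by
  -- Once `ξ.1 = z.2`, the differentiated Euler relation evaluates the term with `η` and `ξ`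
  -- exchanged, and all contributions of `η.2` cancel. Only a condition on `η.1` is left.
  have key : ∀ η : E × E, ξ.1 = z.2 →
      ((fderiv ℝ (vertForm L) z ξ η - fderiv ℝ (vertForm L) z η ξ = - fderiv ℝ L z η) ↔
        vertHess L z ξ.2 η.1 = eulerLagrangeForce L z η.1) := by
    intro η h
    have h1 := fderiv_fderiv_apply_vertical_self hL hom η
    have h2 : fderiv ℝ (fderiv ℝ L) z ξ (0, η.1) = fderiv ℝ (fderiv ℝ L) z (z.2, 0) (0, η.1) +
        fderiv ℝ (fderiv ℝ L) z (0, ξ.2) (0, η.1) := by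
      rw [← add_apply, ← map_add]
      simp [← h]
    have h3 : fderiv ℝ L z η = fderiv ℝ L z (η.1, 0) + fderiv ℝ L z (0, η.2) := by
      rw [← map_add]; simp
    rw [fderiv_vertForm hL, fderiv_vertForm hL, h, h2, vertHess_apply]
    simp only [eulerLagrangeForce, sub_apply, ContinuousLinearMap.comp_apply,
      ContinuousLinearMap.inl_apply, ContinuousLinearMap.inr_apply]
    constructor <;> intro h' <;> linarith
  constructor
  · intro h
    exact ⟨h.fst_eq, by ext a; exact (key (a, 0) h.fst_eq).1 (h.eq (a, 0))⟩
  · rintro ⟨h1, h2⟩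
    exact ⟨h1, fun η => (key η h1).2 (by rw [h2])⟩

/-- The spray of `L` on `E × E`. -/
def sprayModel (L : E × E → ℝ) (z : E × E) : E × E :=
  (z.2, (vertHess L z).inverse (eulerLagrangeForce L z))

/-- Existence and uniqueness at once: the Euler-Lagrange system is linear in `ξ.2` and is solved by
inverting the Hessian. -/
lemma isSprayVector_iff_eq_sprayModel {L : E × E → ℝ} {z : E × E} (hL : ContDiffAt ℝ ∞ L z)
    (hom : HomogeneousNear L z) (hinv : (vertHess L z).IsInvertible) (ξ : E × E) :
    IsSprayVector L z ξ ↔ ξ = sprayModel L z := by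
  rw [isSprayVector_iff hL hom, sprayModel, Prod.ext_iff]
  refine and_congr_right fun _ => ?_
  obtain ⟨e, he⟩ := hinv
  rw [← he, ContinuousLinearMap.inverse_equiv]
  exact e.eq_symm_apply.symm

lemma contDiffAt_vertHess {L : E × E → ℝ} {z : E × E} (hL : ContDiffAt ℝ ∞ L z) :
    ContDiffAt ℝ ∞ (vertHess L) z := by
  have h2 : ContDiffAt ℝ ∞ (fderiv ℝ (fderiv ℝ L)) z :=
    (hL.fderiv_right (m := ∞) (by simp)).fderiv_right (by simp)
  exact contDiffAt_const.clm_comp (h2.clm_comp contDiffAt_const)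

lemma contDiffAt_sprayModel [CompleteSpace E] {L : E × E → ℝ} {z : E × E}
    (hL : ContDiffAt ℝ ∞ L z) (hinv : (vertHess L z).IsInvertible) :
    ContDiffAt ℝ ∞ (sprayModel L) z := by
  have h1 : ContDiffAt ℝ ∞ (fderiv ℝ L) z := hL.fderiv_right (by simp)
  have h2 : ContDiffAt ℝ ∞ (fderiv ℝ (fderiv ℝ L)) z := h1.fderiv_right (by simp)
  have h3 : ContDiffAt ℝ ∞ (fun w : E × E => (w.2, (0 : E))) z :=
    contDiffAt_snd.prodMk contDiffAt_const
  have hf : ContDiffAt ℝ ∞ (eulerLagrangeForce L) z :=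
    (h1.clm_comp contDiffAt_const).sub ((h2.clm_apply h3).clm_comp contDiffAt_const)
  obtain ⟨e, he⟩ := hinv
  have hi : ContDiffAt ℝ ∞ (fun w => (vertHess L w).inverse) z := by
    have := contDiffAt_map_inverse (𝕜 := ℝ) (n := ∞) e
    rw [he] at this
    exact this.comp z (contDiffAt_vertHess hL)
  exact contDiffAt_snd.prodMk (hi.clm_apply hf)

lemma eventually_isInvertible_vertHess [CompleteSpace E] {L : E × E → ℝ} {z : E × E}
    (hL : ContDiffAt ℝ ∞ L z) (hinv : (vertHess L z).IsInvertible) :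
    ∀ᶠ w in 𝓝 z, (vertHess L w).IsInvertible := by
  obtain ⟨e, he⟩ := hinv
  have h := (contDiffAt_vertHess hL).continuousAt.eventually
    (he ▸ ContinuousLinearEquiv.nhds e)
  exact h

/-- Positivity gives injectivity, and `E` has the same dimension as its dual. -/
lemma isInvertible_of_pos [FiniteDimensional ℝ E] (A : E →L[ℝ] E →L[ℝ] ℝ)
    (hA : ∀ w, w ≠ 0 → 0 < A w w) : A.IsInvertible := by
  have hinj : Function.Injective (A : E →ₗ[ℝ] E →L[ℝ] ℝ) := by
    refine (injective_iff_map_eq_zero _).2 fun w hw => ?_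
    by_contra hne
    have := hA w hne
    rw [show A w = 0 from hw] at this
    simp at this
  have hdim : Module.finrank ℝ E = Module.finrank ℝ (E →L[ℝ] ℝ) := by
    rw [← (LinearMap.toContinuousLinearMap (𝕜 := ℝ) (E := E) (F' := ℝ)).finrank_eq]
    exact Subspace.dual_finrank_eq.symm
  exact ⟨(LinearEquiv.ofInjectiveOfFinrankEq (A : E →ₗ[ℝ] E →L[ℝ] ℝ) hinj
    hdim).toContinuousLinearEquiv, by ext; rfl⟩

/-- Sprays of homogeneous Lagrangians are homogeneous of degree 2. -/
lemma IsSprayVector.dilation {L : E × E → ℝ} {z ξ : E × E} {t : ℝ} (ht : 0 < t)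
    (hL : ContDiffAt ℝ ∞ L z) (hLt : ContDiffAt ℝ ∞ L (z.1, t • z.2))
    (hom : HomogeneousNear L z) (hξ : IsSprayVector L z ξ) :
    IsSprayVector L (z.1, t • z.2) (t • (ξ.1, t • ξ.2)) := by
  let m : E × E →L[ℝ] E × E :=
    (ContinuousLinearMap.fst ℝ E E).prod (t • ContinuousLinearMap.snd ℝ E E)
  have hm : ∀ w : E × E, m w = (w.1, t • w.2) := fun w => rfl
  rw [← hm] at hLt ⊢
  -- Since `m` is linear, differentiating this identity twice yields no correction term.
  have heq : L ∘ m =ᶠ[𝓝 z] fun w => t ^ 2 * L w := by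
    filter_upwards [hom] with w hw using hw t ht
  have hD : (fun w => (fderiv ℝ L (m w)).comp m) =ᶠ[𝓝 z] fun w => t ^ 2 • fderiv ℝ L w := by
    filter_upwards [heq.eventuallyEq_nhds, eventually_contDiffAt hL,
      m.continuous.continuousAt.eventually (eventually_contDiffAt hLt)] with w hw h1 h2
    have h3 := ((h2.differentiableAt (by simp)).hasFDerivAt.comp w m.hasFDerivAt)
    have h4 := (h1.differentiableAt (by simp)).hasFDerivAt.const_mul (t ^ 2)
    exact h3.unique (h4.congr_of_eventuallyEq hw)
  have hD1 : ∀ η, fderiv ℝ L (m z) (m η) = t ^ 2 * fderiv ℝ L z η := fun η =>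
    congrArg (fun A => A η) hD.self_of_nhds
  have hD2 : ∀ ξ η, fderiv ℝ (fderiv ℝ L) (m z) (m ξ) (m η) =
      t ^ 2 * fderiv ℝ (fderiv ℝ L) z ξ η := by
    intro ξ η
    have h3 := ((differentiableAt_fderiv_of_contDiffAt hLt).hasFDerivAt.comp z
      m.hasFDerivAt).clm_comp (hasFDerivAt_const m z)
    have h4 := (differentiableAt_fderiv_of_contDiffAt hL).hasFDerivAt.const_smul (t ^ 2)
    have h5 := congrArg (fun A => A ξ η) (h3.unique (h4.congr_of_eventuallyEq hD))
    simpa using h5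
  refine ⟨by simp [hm, hξ.fst_eq], fun η' => ?_⟩
  obtain ⟨η, rfl⟩ : ∃ η, m η = η' := ⟨(η'.1, t⁻¹ • η'.2), by simp [hm, smul_smul, ht.ne']⟩
  have e1 : ∀ a : E, ((0 : E), t • a) = m (0, a) := fun a => rfl
  -- The dilation `m` scales vertical vectors by `t`, so it does not commute with the vertical
  -- endomorphism. The extra factor `t` on the spray vector makes up for this.
  have e2 : fderiv ℝ (fderiv ℝ L) (m z) (t • m ξ) (0, η.1) =
      fderiv ℝ (fderiv ℝ L) (m z) (m ξ) (m (0, η.1)) := by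
    rw [← e1, map_smul, smul_apply, ← map_smul, Prod.smul_mk, smul_zero]
  have h := hξ.eq η
  rw [fderiv_vertForm hL, fderiv_vertForm hL] at h
  rw [fderiv_vertForm hLt, fderiv_vertForm hLt]
  change fderiv ℝ (fderiv ℝ L) (m z) (t • m ξ) (0, η.1) -
    fderiv ℝ (fderiv ℝ L) (m z) (m η) (m (0, ξ.1)) = _
  rw [e2, hD2, hD2, hD1]
  linear_combination t ^ 2 * h

end VectorSpace

/-! ### The tangent bundle and its canonical objects in the preferred charts. -/

section Charts

lemma eventually_mem_target {E M : Type*} [TopologicalSpace E] [TopologicalSpace M]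
    [ChartedSpace E M] {p : M} {z : E × E} (hz : z.1 ∈ (chartAt E p).target) :
    ∀ᶠ w in 𝓝 z, w.1 ∈ (chartAt E p).target :=
  (continuous_fst.tendsto z).eventually ((chartAt E p).open_target.mem_nhds hz)

lemma mfderiv_eq_fderiv_writtenInExtChartAt
    {V : Type*} [NormedAddCommGroup V] [NormedSpace ℝ V] {H : Type*} [TopologicalSpace H]
    {I : ModelWithCorners ℝ V H} [I.Boundaryless] {Q : Type*} [TopologicalSpace Q]
    [ChartedSpace H Q]
    {V' : Type*} [NormedAddCommGroup V'] [NormedSpace ℝ V'] {H' : Type*} [TopologicalSpace H']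
    {I' : ModelWithCorners ℝ V' H'} {Q' : Type*} [TopologicalSpace Q'] [ChartedSpace H' Q']
    {f : Q → Q'} {x : Q} (hf : MDifferentiableAt I I' f x) :
    mfderiv I I' f x = fderiv ℝ (writtenInExtChartAt I I' x f) (extChartAt I x x) := by
  rw [hf.mfderiv, I.range_eq_univ, fderivWithin_univ]

variable {E : Type*} [NormedAddCommGroup E] [NormedSpace ℝ E]
  {M : Type*} [TopologicalSpace M] [ChartedSpace E M] [IsManifold 𝓘(ℝ, E) ∞ M]
  {E' : Type*} [NormedAddCommGroup E'] [NormedSpace ℝ E']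
  {N : Type*} [TopologicalSpace N] [ChartedSpace E' N] [IsManifold 𝓘(ℝ, E') ∞ N]

/-- The preferred chart of the tangent bundle, with values in `E × E`. -/
abbrev tangentChart (v : TangentBundle 𝓘(ℝ, E) M) :
    PartialEquiv (TangentBundle 𝓘(ℝ, E) M) (E × E) :=
  extChartAt 𝓘(ℝ, E).tangent v

lemma mem_tangentChart_source {v w : TangentBundle 𝓘(ℝ, E) M} :
    w ∈ (tangentChart v).source ↔ w.1 ∈ (chartAt E v.1).source := by
  rw [extChartAt_source]; exact TangentBundle.mem_chart_source_iff w v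

lemma mem_tangentChart_target {v : TangentBundle 𝓘(ℝ, E) M} {z : E × E} :
    z ∈ (tangentChart v).target ↔ z.1 ∈ (chartAt E v.1).target := by
  rw [extChartAt_target]
  simp only [ModelWithCorners.range_eq_univ, Set.inter_univ]
  exact TangentBundle.mem_chart_target_iff z v

lemma tangentChart_apply {v w : TangentBundle 𝓘(ℝ, E) M} (hw : w.1 ∈ (chartAt E v.1).source) :
    tangentChart v w =
      (chartAt E v.1 w.1, mfderiv 𝓘(ℝ, E) 𝓘(ℝ, E) (chartAt E v.1) w.1 w.2) :=
  (congrArg (Bundle.TotalSpace.toProd E E)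
    (tangentMap_chart (I := 𝓘(ℝ, E)) (p := v) (q := w) hw)).symm

lemma tangentChart_symm_apply (v : TangentBundle 𝓘(ℝ, E) M) {z : E × E}
    (hz : z.1 ∈ (chartAt E v.1).target) :
    (tangentChart v).symm z =
      tangentMap 𝓘(ℝ, E) 𝓘(ℝ, E) (chartAt E v.1).symm (⟨z.1, z.2⟩ : TangentBundle 𝓘(ℝ, E) E) :=
  (tangentMap_chart_symm (I := 𝓘(ℝ, E)) (p := v) (q := ⟨z.1, z.2⟩) hz).symm

lemma mfderiv_chartAt_self (p : M) :
    mfderiv 𝓘(ℝ, E) 𝓘(ℝ, E) (chartAt E p) p = ContinuousLinearMap.id ℝ E :=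
  mfderiv_extChartAt_self (I := 𝓘(ℝ, E)) (x := p)

/-- The preferred chart at a point has identity derivative there, so fibre coordinates over the base
point of `v` are unchanged. -/
lemma tangentChart_fiberIncl (v : TangentBundle 𝓘(ℝ, E) M) (u : E) :
    tangentChart v (fiberIncl v.1 u) = (chartAt E v.1 v.1, u) := by
  refine (tangentChart_apply (w := fiberIncl v.1 u) (mem_chart_source E v.1)).trans ?_
  change (_, mfderiv 𝓘(ℝ, E) 𝓘(ℝ, E) (chartAt E v.1) v.1 u) = _
  rw [mfderiv_chartAt_self]; rfl

lemma tangentChart_self (v : TangentBundle 𝓘(ℝ, E) M) :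
    tangentChart v v = (chartAt E v.1 v.1, v.2) :=
  tangentChart_fiberIncl v v.2

lemma fiberIncl_eq (v : TangentBundle 𝓘(ℝ, E) M) (u : E) :
    fiberIncl v.1 u = (tangentChart v).symm (chartAt E v.1 v.1, u) := by
  rw [← tangentChart_fiberIncl, (tangentChart v).left_inv]
  exact mem_tangentChart_source.2 (mem_chart_source E v.1)

lemma chartAt_mem_target (v : TangentBundle 𝓘(ℝ, E) M) :
    (tangentChart v v).1 ∈ (chartAt E v.1).target := by
  rw [tangentChart_self]; exact mem_chart_target E v.1

/-- A map between manifolds in the charts at `p` and `q`. -/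
def chartRep (φ : M → N) (p : M) (q : N) (x : E) : E' := chartAt E' q (φ ((chartAt E p).symm x))

lemma contDiffAt_chartRep {φ : M → N} {p : M} {q : N} {x : E}
    (hx : x ∈ (chartAt E p).target)
    (hφ : ContMDiffAt 𝓘(ℝ, E) 𝓘(ℝ, E') ∞ φ ((chartAt E p).symm x))
    (hq : φ ((chartAt E p).symm x) ∈ (chartAt E' q).source) :
    ContDiffAt ℝ ∞ (chartRep φ p q : E → E') x := by
  have h1 : ContMDiffAt 𝓘(ℝ, E) 𝓘(ℝ, E) ∞ (chartAt E p).symm x :=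
    contMDiffOn_chart_symm.contMDiffAt ((chartAt E p).open_target.mem_nhds hx)
  have h2 : ContMDiffAt 𝓘(ℝ, E') 𝓘(ℝ, E') ∞ (chartAt E' q) (φ ((chartAt E p).symm x)) :=
    contMDiffOn_chart.contMDiffAt ((chartAt E' q).open_source.mem_nhds hq)
  exact (h2.comp x (hφ.comp x h1)).contDiffAt

lemma fderiv_chartRep {φ : M → N} {p : M} {q : N} {x : E}
    (hx : x ∈ (chartAt E p).target)
    (hφ : MDifferentiableAt 𝓘(ℝ, E) 𝓘(ℝ, E') φ ((chartAt E p).symm x))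
    (hq : φ ((chartAt E p).symm x) ∈ (chartAt E' q).source) :
    fderiv ℝ (chartRep φ p q : E → E') x =
      (mfderiv 𝓘(ℝ, E') 𝓘(ℝ, E') (chartAt E' q) (φ ((chartAt E p).symm x))).comp
        ((mfderiv 𝓘(ℝ, E) 𝓘(ℝ, E') φ ((chartAt E p).symm x)).comp
          (mfderiv 𝓘(ℝ, E) 𝓘(ℝ, E) (chartAt E p).symm x)) := by
  have h1 : MDifferentiableAt 𝓘(ℝ, E) 𝓘(ℝ, E) (chartAt E p).symm x :=
    mdifferentiableAt_atlas_symm (chart_mem_atlas E p) hx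
  have h2 : MDifferentiableAt 𝓘(ℝ, E') 𝓘(ℝ, E') (chartAt E' q) (φ ((chartAt E p).symm x)) :=
    mdifferentiableAt_atlas (chart_mem_atlas E' q) hq
  exact (mfderiv_eq_fderiv (𝕜 := ℝ)).symm.trans
    ((mfderiv_comp x h2 (hφ.comp x h1)).trans (congrArg _ (mfderiv_comp x hφ h1)))

/-- The tangent map in the preferred charts. -/
lemma tangentChart_tangentMap {φ : M → N} {v : TangentBundle 𝓘(ℝ, E) M}
    {v' : TangentBundle 𝓘(ℝ, E') N} {z : E × E} (hz : z.1 ∈ (chartAt E v.1).target)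
    (hφ : MDifferentiableAt 𝓘(ℝ, E) 𝓘(ℝ, E') φ ((chartAt E v.1).symm z.1))
    (hq : φ ((chartAt E v.1).symm z.1) ∈ (chartAt E' v'.1).source) :
    tangentChart v' (tangentMap 𝓘(ℝ, E) 𝓘(ℝ, E') φ ((tangentChart v).symm z)) =
      tangentModel (chartRep φ v.1 v'.1) z := by
  rw [tangentChart_symm_apply v hz, tangentChart_apply hq, tangentModel, fderiv_chartRep hz hφ hq]
  rfl

lemma contMDiffOn_tangentChart (v : TangentBundle 𝓘(ℝ, E) M) :
    ContMDiffOn 𝓘(ℝ, E).tangent 𝓘(ℝ, E × E) ∞ (tangentChart v) (tangentChart v).source := by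
  rw [extChartAt_source]; exact contMDiffOn_extChartAt

lemma contMDiffAt_tangentChart_symm (v : TangentBundle 𝓘(ℝ, E) M) {z : E × E}
    (hz : z.1 ∈ (chartAt E v.1).target) :
    ContMDiffAt 𝓘(ℝ, E × E) 𝓘(ℝ, E).tangent ∞ (tangentChart v).symm z :=
  (contMDiffOn_extChartAt_symm v).contMDiffAt
    ((isOpen_extChartAt_target v).mem_nhds (mem_tangentChart_target.2 hz))

lemma proj_tangentChart_symm (v : TangentBundle 𝓘(ℝ, E) M) {z : E × E}
    (hz : z.1 ∈ (chartAt E v.1).target) :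
    ((tangentChart v).symm z).1 = (chartAt E v.1).symm z.1 := by
  rw [tangentChart_symm_apply v hz]; rfl

lemma mfderiv_proj (v : TangentBundle 𝓘(ℝ, E) M) (ξ : E × E) :
    mfderiv 𝓘(ℝ, E).tangent 𝓘(ℝ, E) (fun w : TangentBundle 𝓘(ℝ, E) M => w.1) v ξ = ξ.1 := by
  have hd : MDifferentiableAt 𝓘(ℝ, E).tangent 𝓘(ℝ, E)
      (fun w : TangentBundle 𝓘(ℝ, E) M => w.1) v :=
    (Bundle.contMDiffAt_proj (n := 1) (TangentSpace 𝓘(ℝ, E))).mdifferentiableAt (by simp)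
  rw [mfderiv_eq_fderiv_writtenInExtChartAt hd]
  have h : writtenInExtChartAt 𝓘(ℝ, E).tangent 𝓘(ℝ, E) v
      (fun w : TangentBundle 𝓘(ℝ, E) M => w.1) =ᶠ[𝓝 (tangentChart v v)] Prod.fst := by
    filter_upwards [eventually_mem_target (chartAt_mem_target v)] with z hz
    change chartAt E v.1 ((tangentChart v).symm z).1 = z.1
    rw [proj_tangentChart_symm v hz, (chartAt E v.1).right_inv hz]
  rw [h.fderiv_eq, fderiv_fst]
  rfl

lemma contMDiff_fiberIncl (p : M) :
    ContMDiff 𝓘(ℝ, E) 𝓘(ℝ, E).tangent ∞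
      (fun u : E => (fiberIncl p u : TangentBundle 𝓘(ℝ, E) M)) := by
  intro u
  have h1 : ContMDiffAt 𝓘(ℝ, E) 𝓘(ℝ, E × E) ∞ (fun u : E => (chartAt E p p, u)) u :=
    (contDiffAt_const.prodMk contDiffAt_id).contMDiffAt
  have h2 := (contMDiffAt_tangentChart_symm (z := (chartAt E p p, u)) (fiberIncl p u)
    (mem_chart_target E p)).comp u h1
  exact h2.congr_of_eventuallyEq (.of_forall fun u' => fiberIncl_eq (fiberIncl p u) u')

lemma mfderiv_fiberIncl_apply (p : M) (y u : E) :
    mfderiv 𝓘(ℝ, E) 𝓘(ℝ, E).tangent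
      (fun u : E => (fiberIncl p u : TangentBundle 𝓘(ℝ, E) M)) y u = ((0 : E), u) := by
  rw [mfderiv_eq_fderiv_writtenInExtChartAt ((contMDiff_fiberIncl p).mdifferentiableAt (by simp))]
  have h : writtenInExtChartAt 𝓘(ℝ, E) 𝓘(ℝ, E).tangent y
      (fun u : E => (fiberIncl p u : TangentBundle 𝓘(ℝ, E) M)) =
        fun u => (chartAt E p p, u) := by
    funext u
    exact tangentChart_fiberIncl (fiberIncl p y) u
  rw [h]
  have h1 := ((hasFDerivAt_const (chartAt E p p) y).prodMk (hasFDerivAt_id (𝕜 := ℝ) y)).fderiv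
  exact congrArg (fun A : E →L[ℝ] E × E => A u) h1

lemma vlift_apply (v : TangentBundle 𝓘(ℝ, E) M) (u : E) : vlift v u = ((0 : E), u) :=
  mfderiv_fiberIncl_apply (E := E) v.1 v.2 u

lemma vertEndo_apply (v : TangentBundle 𝓘(ℝ, E) M) (ξ : E × E) :
    vertEndo v ξ = vertModel E ξ :=
  (vlift_apply v _).trans (congrArg (Prod.mk 0) (mfderiv_proj v ξ))

lemma liouville_eq (v : TangentBundle 𝓘(ℝ, E) M) : liouville v = ((0 : E), (v.2 : E)) :=
  vlift_apply v v.2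

lemma vertEndo_eq_liouville_iff (v : TangentBundle 𝓘(ℝ, E) M) (ξ : E × E) :
    vertEndo v ξ = liouville v ↔ ξ.1 = v.2 := by
  rw [vertEndo_apply, liouville_eq]
  exact Prod.ext_iff.trans (and_iff_right rfl)

lemma eventually_tangentChart_tangentMap {φ : M → N}
    (hφ : ContMDiff 𝓘(ℝ, E) 𝓘(ℝ, E') ∞ φ) {v : TangentBundle 𝓘(ℝ, E) M}
    {v' : TangentBundle 𝓘(ℝ, E') N} {z : E × E} (hz : z.1 ∈ (chartAt E v.1).target)
    (hq : φ ((chartAt E v.1).symm z.1) ∈ (chartAt E' v'.1).source) :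
    ∀ᶠ w in 𝓝 z, tangentChart v' (tangentMap 𝓘(ℝ, E) 𝓘(ℝ, E') φ ((tangentChart v).symm w)) =
      tangentModel (chartRep φ v.1 v'.1) w := by
  have hc : ContinuousAt (fun w : E × E => φ ((chartAt E v.1).symm w.1)) z :=
    hφ.continuous.continuousAt.comp
      (((chartAt E v.1).continuousAt_symm hz).comp continuous_fst.continuousAt)
  filter_upwards [eventually_mem_target hz,
    hc.eventually ((chartAt E' v'.1).open_source.mem_nhds hq)] with w h1 h2
  exact tangentChart_tangentMap h1 (hφ.mdifferentiableAt (by simp)) h2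

lemma eventually_contDiffAt_chartRep {φ : M → N}
    (hφ : ContMDiff 𝓘(ℝ, E) 𝓘(ℝ, E') ∞ φ) {p : M} {q : N} {x : E}
    (hx : x ∈ (chartAt E p).target)
    (hq : φ ((chartAt E p).symm x) ∈ (chartAt E' q).source) :
    ∀ᶠ y in 𝓝 x, ContDiffAt ℝ ∞ (chartRep φ p q : E → E') y := by
  have hc : ContinuousAt (fun y : E => φ ((chartAt E p).symm y)) x :=
    hφ.continuous.continuousAt.comp ((chartAt E p).continuousAt_symm hx)
  filter_upwards [(chartAt E p).open_target.mem_nhds hx,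
    hc.eventually ((chartAt E' q).open_source.mem_nhds hq)] with y h1 h2
  exact contDiffAt_chartRep h1 hφ.contMDiffAt h2

/-- The derivative of a tangent map, in the coordinates of the preferred charts. -/
lemma mfderiv_tangentMap {φ : M → N} (hφ : ContMDiff 𝓘(ℝ, E) 𝓘(ℝ, E') ∞ φ)
    (v : TangentBundle 𝓘(ℝ, E) M) :
    mfderiv 𝓘(ℝ, E).tangent 𝓘(ℝ, E').tangent (tangentMap 𝓘(ℝ, E) 𝓘(ℝ, E') φ) v =
      fderiv ℝ (tangentModel (chartRep φ v.1 (φ v.1))) (tangentChart v v) := by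
  have hd : ContMDiff 𝓘(ℝ, E).tangent 𝓘(ℝ, E').tangent ∞ (tangentMap 𝓘(ℝ, E) 𝓘(ℝ, E') φ) :=
    hφ.contMDiff_tangentMap (by simp)
  rw [mfderiv_eq_fderiv_writtenInExtChartAt (hd.mdifferentiableAt (by simp))]
  refine Filter.EventuallyEq.fderiv_eq
    (eventually_tangentChart_tangentMap hφ (v' := tangentMap 𝓘(ℝ, E) 𝓘(ℝ, E') φ v)
      (chartAt_mem_target v) ?_)
  rw [tangentChart_self, (chartAt E v.1).left_inv (mem_chart_source E v.1)]
  exact mem_chart_source E' _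

/-- The derivative of the inverse of a preferred chart. -/
lemma mfderiv_tangentChart_symm (v : TangentBundle 𝓘(ℝ, E) M) {z : E × E}
    (hz : z.1 ∈ (chartAt E v.1).target) :
    mfderiv 𝓘(ℝ, E × E) 𝓘(ℝ, E).tangent (tangentChart v).symm z =
      fderiv ℝ (tangentModel (chartRep (id : M → M) v.1 ((chartAt E v.1).symm z.1))) z := by
  rw [mfderiv_eq_fderiv_writtenInExtChartAt
    ((contMDiffAt_tangentChart_symm v hz).mdifferentiableAt (by simp))]
  have h := eventually_tangentChart_tangentMap (φ := (id : M → M)) contMDiff_id (v := v)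
    (v' := (tangentChart v).symm z) hz
    (by rw [proj_tangentChart_symm v hz]; exact mem_chart_source E _)
  rw [proj_tangentChart_symm v hz] at h
  refine Filter.EventuallyEq.fderiv_eq (h.mono fun w hw => ?_)
  rw [tangentMap_id] at hw
  exact hw

/-- The chart at `v` is used at points other than `v`, where `vertEndo` has its model form in a
different preferred chart. The coordinate change between the two is a tangent map and hence commutes
with `vertModel`. -/
lemma oneFormInChart_diff_vertEndo {f : TangentBundle 𝓘(ℝ, E) M → ℝ}
    (v : TangentBundle 𝓘(ℝ, E) M) {z : E × E} (hz : z.1 ∈ (chartAt E v.1).target)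
    (hf : MDifferentiableAt 𝓘(ℝ, E).tangent 𝓘(ℝ, ℝ) f ((tangentChart v).symm z)) :
    oneFormInChart 𝓘(ℝ, E).tangent (fun w => (diff f w).comp (vertEndo w)) v z =
      vertForm (f ∘ (tangentChart v).symm) z := by
  refine ContinuousLinearMap.ext fun ξ => ?_
  have hh : ContDiffAt ℝ ∞ (chartRep (id : M → M) v.1 ((chartAt E v.1).symm z.1)) z.1 :=
    contDiffAt_chartRep hz contMDiffAt_id (mem_chart_source E _)
  have hD := mfderiv_tangentChart_symm v hz
  have h1 : fderiv ℝ (f ∘ (tangentChart v).symm) z = _ := (mfderiv_eq_fderiv (𝕜 := ℝ)).symm.trans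
    (mfderiv_comp z hf ((contMDiffAt_tangentChart_symm v hz).mdifferentiableAt (by simp)))
  have h2 : vertEndo ((tangentChart v).symm z)
      (mfderiv 𝓘(ℝ, E × E) 𝓘(ℝ, E).tangent (tangentChart v).symm z ξ) =
      mfderiv 𝓘(ℝ, E × E) 𝓘(ℝ, E).tangent (tangentChart v).symm z (vertModel E ξ) := by
    rw [hD]
    refine (vertEndo_apply _ _).trans ?_
    erw [fderiv_tangentModel hh, fderiv_tangentModel hh]
    simp
    rfl
  rw [vertForm, h1]
  exact congrArg (diff f ((tangentChart v).symm z)) h2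

end Charts

/-! ### The Finsler energy in charts and the local form of the spray equation. -/

section Energy

variable {E : Type*} [NormedAddCommGroup E] [NormedSpace ℝ E]
  {M : Type*} [TopologicalSpace M] [ChartedSpace E M] [IsManifold 𝓘(ℝ, E) ∞ M]
  {E' : Type*} [NormedAddCommGroup E'] [NormedSpace ℝ E']
  {N : Type*} [TopologicalSpace N] [ChartedSpace E' N] [IsManifold 𝓘(ℝ, E') ∞ N]

/-- In a chart the fibre coordinate depends linearly on the vector, so where it is nonzero the
vector is nonzero. -/
lemma isOpen_slit : IsOpen (slit E M) := by
  refine isOpen_iff_mem_nhds.2 fun v hv => ?_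
  have hc : ContinuousAt (fun w => (tangentChart v w).2) v :=
    continuous_snd.continuousAt.comp (continuousAt_extChartAt v)
  have h0 : (tangentChart v v).2 ≠ 0 := by rw [tangentChart_self]; exact hv
  filter_upwards [hc.eventually (isOpen_ne.mem_nhds h0),
    extChartAt_source_mem_nhds (I := 𝓘(ℝ, E).tangent) v] with w h1 h2 h3
  refine h1 ?_
  rw [tangentChart_apply (mem_tangentChart_source.1 h2)]
  dsimp only
  rw [h3]
  exact map_zero _

/-- The energy in the preferred chart at `v`. -/
def chartEnergy (F : TangentBundle 𝓘(ℝ, E) M → ℝ) (v : TangentBundle 𝓘(ℝ, E) M) : E × E → ℝ :=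
  energy F ∘ (tangentChart v).symm

lemma IsFinslerFunction.contMDiffAt_energy {F : TangentBundle 𝓘(ℝ, E) M → ℝ}
    (hF : IsFinslerFunction F) {v : TangentBundle 𝓘(ℝ, E) M} (hv : v ∈ slit E M) :
    ContMDiffAt 𝓘(ℝ, E).tangent 𝓘(ℝ, ℝ) ∞ (energy F) v := by
  have h1 := hF.smooth.contMDiffAt (isOpen_slit.mem_nhds hv)
  have h2 : ContDiff ℝ ∞ (fun x : ℝ => (1 / 2) * x ^ 2) := by fun_prop
  exact h2.contMDiff.contMDiffAt.comp v h1

lemma IsFinslerFunction.contDiffAt_chartEnergy {F : TangentBundle 𝓘(ℝ, E) M → ℝ}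
    (hF : IsFinslerFunction F) (v : TangentBundle 𝓘(ℝ, E) M) {z : E × E}
    (hz : z.1 ∈ (chartAt E v.1).target) (hz' : (tangentChart v).symm z ∈ slit E M) :
    ContDiffAt ℝ ∞ (chartEnergy F v) z :=
  ((hF.contMDiffAt_energy hz').comp z (contMDiffAt_tangentChart_symm v hz)).contDiffAt

lemma tangentChart_fst_mem_target {v w : TangentBundle 𝓘(ℝ, E) M}
    (hw : w.1 ∈ (chartAt E v.1).source) :
    (tangentChart v w).1 ∈ (chartAt E v.1).target := by
  rw [tangentChart_apply hw]; exact (chartAt E v.1).map_source hw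

lemma tangentChart_left_inv {v w : TangentBundle 𝓘(ℝ, E) M}
    (hw : w.1 ∈ (chartAt E v.1).source) : (tangentChart v).symm (tangentChart v w) = w :=
  (tangentChart v).left_inv (mem_tangentChart_source.2 hw)

lemma IsFinslerFunction.contDiffAt_chartEnergy_tangentChart {F : TangentBundle 𝓘(ℝ, E) M → ℝ}
    (hF : IsFinslerFunction F) {v w : TangentBundle 𝓘(ℝ, E) M}
    (hw : w.1 ∈ (chartAt E v.1).source) (hw' : w ∈ slit E M) :
    ContDiffAt ℝ ∞ (chartEnergy F v) (tangentChart v w) :=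
  hF.contDiffAt_chartEnergy v (tangentChart_fst_mem_target hw)
    (by rwa [tangentChart_left_inv hw])

lemma tangentChart_symm_dilation (v : TangentBundle 𝓘(ℝ, E) M) {z : E × E}
    (hz : z.1 ∈ (chartAt E v.1).target) (t : ℝ) :
    (tangentChart v).symm (z.1, t • z.2) = dilation t ((tangentChart v).symm z) := by
  rw [tangentChart_symm_apply v hz]
  refine (tangentChart_symm_apply v (z := (z.1, t • z.2)) hz).trans ?_
  simp only [dilation, tangentMap]
  congr 1
  exact map_smul (mfderiv 𝓘(ℝ, E) 𝓘(ℝ, E) (chartAt E v.1).symm z.1) t z.2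

lemma IsFinslerFunction.energy_dilation {F : TangentBundle 𝓘(ℝ, E) M → ℝ}
    (hF : IsFinslerFunction F) {t : ℝ} (ht : 0 < t) (v : TangentBundle 𝓘(ℝ, E) M) :
    energy F (dilation t v) = t ^ 2 * energy F v := by
  rw [energy, hF.homogeneous t v ht, energy]; ring

lemma IsFinslerFunction.homogeneousNear_chartEnergy {F : TangentBundle 𝓘(ℝ, E) M → ℝ}
    (hF : IsFinslerFunction F) (v : TangentBundle 𝓘(ℝ, E) M) {z : E × E}
    (hz : z.1 ∈ (chartAt E v.1).target) : HomogeneousNear (chartEnergy F v) z := by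
  filter_upwards [eventually_mem_target hz] with w hw t ht
  rw [chartEnergy, Function.comp_apply, tangentChart_symm_dilation v hw, hF.energy_dilation ht]
  rfl

/-- Translates ellipticity, stated for `F²` on a fibre, to the energy in a chart; the factor 2 comes
from `F² = 2 · energy`. -/
lemma IsFinslerFunction.vertHess_chartEnergy_self {F : TangentBundle 𝓘(ℝ, E) M → ℝ}
    (hF : IsFinslerFunction F) {v : TangentBundle 𝓘(ℝ, E) M} (hv : v ∈ slit E M) (b a : E) :
    fderiv ℝ (fderiv ℝ (fiberSq F v.1)) (v.2 : E) b a =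
      2 * vertHess (chartEnergy F v) (tangentChart v v) b a := by
  set L := chartEnergy F v
  set y : E := v.2
  set x : E := chartAt E v.1 v.1
  have hL : ContDiffAt ℝ ∞ L (x, y) := by
    have := hF.contDiffAt_chartEnergy_tangentChart (mem_chart_source E v.1) hv
    rwa [tangentChart_self] at this
  have hi : ∀ u : E, HasFDerivAt (fun u : E => (x, u)) (ContinuousLinearMap.inr ℝ E E) u :=
    fun u => (hasFDerivAt_const x u).prodMk (hasFDerivAt_id u)
  have h0 : fiberSq F v.1 = fun u => 2 * L (x, u) := by
    funext u
    change _ = 2 * energy F ((tangentChart v).symm (x, u))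
    rw [← fiberIncl_eq, energy, fiberSq]; ring
  have h1 : fderiv ℝ (fiberSq F v.1) =ᶠ[𝓝 y]
      fun u => (2 : ℝ) • (fderiv ℝ L (x, u)).comp (ContinuousLinearMap.inr ℝ E E) := by
    filter_upwards [(hi y).continuousAt.eventually (eventually_contDiffAt hL)] with u hu
    rw [h0]
    exact (((hu.differentiableAt (by simp)).hasFDerivAt.comp u (hi u)).const_mul 2).fderiv
  have h2 := ((((differentiableAt_fderiv_of_contDiffAt hL).hasFDerivAt.comp y (hi y)).clm_comp
    (hasFDerivAt_const (ContinuousLinearMap.inr ℝ E E) y)).const_smul (2 : ℝ))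
  have h3 := congrArg (fun A => A b a) (h2.congr_of_eventuallyEq h1).fderiv
  rw [show tangentChart v v = (x, y) from tangentChart_self v, vertHess_apply]
  simpa using h3

lemma IsFinslerFunction.isInvertible_vertHess [FiniteDimensional ℝ E]
    {F : TangentBundle 𝓘(ℝ, E) M → ℝ}
    (hF : IsFinslerFunction F) {v : TangentBundle 𝓘(ℝ, E) M} (hv : v ∈ slit E M) :
    (vertHess (chartEnergy F v) (tangentChart v v)).IsInvertible :=
  isInvertible_of_pos _ fun w hw => by
    have := hF.elliptic v.1 v.2 w hv hw
    rw [hF.vertHess_chartEnergy_self hv] at this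
    linarith

/-- Bridge between the intrinsic equation and the model on `E × E`. The exterior derivative at `v`
is computed in the chart at `v`, whose derivative at `v` is the identity. -/
lemma IsFinslerFunction.isSprayVector_iff_canonical {F : TangentBundle 𝓘(ℝ, E) M → ℝ}
    (hF : IsFinslerFunction F) {v : TangentBundle 𝓘(ℝ, E) M} (hv : v ∈ slit E M) (ξ : E × E) :
    IsSprayVector (chartEnergy F v) (tangentChart v v) ξ ↔
      vertEndo v ξ = liouville v ∧ ∀ η : TangentSpace 𝓘(ℝ, E).tangent v,
        oneFormExtDeriv 𝓘(ℝ, E).tangent (fun w => (diff (energy F) w).comp (vertEndo w)) v ξ η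
          = - diff (energy F) v η := by
  have h1 : oneFormInChart 𝓘(ℝ, E).tangent (fun w => (diff (energy F) w).comp (vertEndo w)) v
      =ᶠ[𝓝 (tangentChart v v)] vertForm (chartEnergy F v) := by
    have hc : ContinuousAt (tangentChart v).symm (tangentChart v v) :=
      (contMDiffAt_tangentChart_symm v (chartAt_mem_target v)).continuousAt
    have hs : slit E M ∈ 𝓝 ((tangentChart v).symm (tangentChart v v)) := by
      rw [tangentChart_left_inv (mem_chart_source E v.1)]
      exact isOpen_slit.mem_nhds hv
    filter_upwards [eventually_mem_target (chartAt_mem_target v), hc.eventually hs] with z hz hz'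
    exact oneFormInChart_diff_vertEndo v hz ((hF.contMDiffAt_energy hz').mdifferentiableAt (by simp))
  have h2 : diff (energy F) v = fderiv ℝ (chartEnergy F v) (tangentChart v v) :=
    mfderiv_eq_fderiv_writtenInExtChartAt
      ((hF.contMDiffAt_energy hv).mdifferentiableAt (by simp))
  have h3 : mfderiv 𝓘(ℝ, E).tangent 𝓘(ℝ, E × E) (extChartAt 𝓘(ℝ, E).tangent v) v =
      ContinuousLinearMap.id ℝ (E × E) := mfderiv_extChartAt_self
  have h4 : ∀ η : E × E,
      oneFormExtDeriv 𝓘(ℝ, E).tangent (fun w => (diff (energy F) w).comp (vertEndo w)) v ξ η =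
        fderiv ℝ (vertForm (chartEnergy F v)) (tangentChart v v) ξ η -
          fderiv ℝ (vertForm (chartEnergy F v)) (tangentChart v v) η ξ := by
    intro η
    have e : ∀ η : E × E,
        (mfderiv 𝓘(ℝ, E).tangent 𝓘(ℝ, E × E) (extChartAt 𝓘(ℝ, E).tangent v) v η : E × E) = η :=
      fun η => congrArg (fun A : E × E →L[ℝ] E × E => A η) h3
    rw [← h1.fderiv_eq]
    set D := fderiv ℝ (oneFormInChart 𝓘(ℝ, E).tangent
      (fun w => (diff (energy F) w).comp (vertEndo w)) v) (tangentChart v v)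
    exact congrArg₂ (· - ·) (congrArg₂ (fun a b => D a b) (e ξ) (e η))
      (congrArg₂ (fun a b => D a b) (e η) (e ξ))
  rw [vertEndo_eq_liouville_iff, h2]
  constructor
  · intro h
    exact ⟨by rw [h.fst_eq, tangentChart_self], fun η => (h4 η).trans (h.eq η)⟩
  · rintro ⟨h, h'⟩
    exact ⟨by rw [h, tangentChart_self], fun η => (h4 η).symm.trans (h' η)⟩

/-- The derivative is block triangular with `Dh` in both diagonal blocks. -/
lemma tangentModel_surjective {h : E → E'} {z : E × E} (hh : ContDiffAt ℝ ∞ h z.1)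
    (hs : Function.Surjective (fderiv ℝ h z.1)) :
    Function.Surjective (fderiv ℝ (tangentModel h) z) := by
  rintro ⟨a', b'⟩
  obtain ⟨a, rfl⟩ := hs a'
  obtain ⟨b, hb⟩ := hs (b' - fderiv ℝ (fderiv ℝ h) z.1 a z.2)
  exact ⟨(a, b), by rw [fderiv_tangentModel hh]; simp [hb]⟩

lemma surjective_fderiv_chartRep {φ : M → N} {p : M} {q : N} {x : E}
    (hx : x ∈ (chartAt E p).target)
    (hφ : MDifferentiableAt 𝓘(ℝ, E) 𝓘(ℝ, E') φ ((chartAt E p).symm x))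
    (hq : φ ((chartAt E p).symm x) ∈ (chartAt E' q).source)
    (hs : Function.Surjective (mfderiv 𝓘(ℝ, E) 𝓘(ℝ, E') φ ((chartAt E p).symm x))) :
    Function.Surjective (fderiv ℝ (chartRep φ p q : E → E') x) := by
  rw [fderiv_chartRep hx hφ hq]
  exact ((mdifferentiable_chart q).mfderiv_surjective hq).comp
    (hs.comp ((mdifferentiable_chart p).symm.mfderiv_surjective hx))

/-- Smooth submersions preserving the energy map spray vectors to spray vectors. -/
theorem IsSprayVector.map_tangentMap {F : TangentBundle 𝓘(ℝ, E) M → ℝ}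
    {F' : TangentBundle 𝓘(ℝ, E') N → ℝ} (hF' : IsFinslerFunction F') {φ : M → N}
    (hφ : ContMDiff 𝓘(ℝ, E) 𝓘(ℝ, E') ∞ φ)
    (hiso : ∀ v, F' (tangentMap 𝓘(ℝ, E) 𝓘(ℝ, E') φ v) = F v)
    {v w : TangentBundle 𝓘(ℝ, E) M} {v' : TangentBundle 𝓘(ℝ, E') N}
    (hs : Function.Surjective (mfderiv 𝓘(ℝ, E) 𝓘(ℝ, E') φ w.1))
    (hw : w.1 ∈ (chartAt E v.1).source) (hw' : φ w.1 ∈ (chartAt E' v'.1).source)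
    (hslit : tangentMap 𝓘(ℝ, E) 𝓘(ℝ, E') φ w ∈ slit E' N) {ξ : E × E}
    (hξ : IsSprayVector (chartEnergy F v) (tangentChart v w) ξ) :
    IsSprayVector (chartEnergy F' v')
      (tangentChart v' (tangentMap 𝓘(ℝ, E) 𝓘(ℝ, E') φ w))
      (fderiv ℝ (tangentModel (chartRep φ v.1 v'.1)) (tangentChart v w) ξ) := by
  have hz := tangentChart_fst_mem_target hw
  have hp : (chartAt E v.1).symm (tangentChart v w).1 = w.1 := by
    rw [tangentChart_apply hw]; exact (chartAt E v.1).left_inv hw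
  have hq : φ ((chartAt E v.1).symm (tangentChart v w).1) ∈ (chartAt E' v'.1).source := by
    rwa [hp]
  have hh := eventually_contDiffAt_chartRep hφ hz hq
  have hev := eventually_tangentChart_tangentMap hφ hz hq
  have hg : tangentModel (chartRep φ v.1 v'.1) (tangentChart v w) =
      tangentChart v' (tangentMap 𝓘(ℝ, E) 𝓘(ℝ, E') φ w) := by
    rw [← hev.self_of_nhds, tangentChart_left_inv hw]
  rw [← hg]
  refine hξ.map hh ?_ ?_ (tangentModel_surjective hh.self_of_nhds
    (surjective_fderiv_chartRep hz (hφ.mdifferentiableAt (by simp)) hq (by rwa [hp])))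
  · rw [hg]
    exact hF'.contDiffAt_chartEnergy_tangentChart (w := tangentMap 𝓘(ℝ, E) 𝓘(ℝ, E') φ w) hw' hslit
  · have hc : ContinuousAt (fun z : E × E => φ ((chartAt E v.1).symm z.1)) (tangentChart v w) :=
      hφ.continuous.continuousAt.comp
        (((chartAt E v.1).continuousAt_symm hz).comp continuous_fst.continuousAt)
    filter_upwards [hev, eventually_mem_target hz,
      hc.eventually ((chartAt E' v'.1).open_source.mem_nhds hq)] with z h1 h2 h3
    rw [Function.comp_apply, ← h1, chartEnergy, Function.comp_apply, chartEnergy,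
      Function.comp_apply, tangentChart_left_inv, energy, energy, hiso]
    rw [← proj_tangentChart_symm v h2] at h3
    exact h3

end Energy

/-! ### Velocities of image curves, and the reduction of isometries to local isometries. -/

section Maps

variable {E : Type*} [NormedAddCommGroup E] [NormedSpace ℝ E]
  {M : Type*} [TopologicalSpace M] [ChartedSpace E M]
  {E' : Type*} [NormedAddCommGroup E'] [NormedSpace ℝ E']
  {N : Type*} [TopologicalSpace N] [ChartedSpace E' N]

/-- Chain rule for derivatives within `s`; unique differentiability covers one-sided derivatives at
end points. -/
lemma velocity_comp {φ : M → N} (hφ : ContMDiff 𝓘(ℝ, E) 𝓘(ℝ, E') ∞ φ) {γ : ℝ → M} {s : Set ℝ}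
    (hs : UniqueDiffOn ℝ s) (hγ : ContMDiffOn 𝓘(ℝ, ℝ) 𝓘(ℝ, E) ∞ γ s) {t : ℝ} (ht : t ∈ s) :
    velocity (φ ∘ γ) s t = tangentMap 𝓘(ℝ, E) 𝓘(ℝ, E') φ (velocity γ s t) := by
  have h := mfderiv_comp_mfderivWithin (I := 𝓘(ℝ, ℝ)) t
    (hφ.mdifferentiableAt (x := γ t) (by simp)) ((hγ t ht).mdifferentiableWithinAt (by simp))
    (hs t ht).uniqueMDiffWithinAt
  exact congrArg (fun A : ℝ →L[ℝ] E' => (⟨φ (γ t), A 1⟩ : TangentBundle 𝓘(ℝ, E') N)) h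

lemma IsFinslerIsometry.isLocalFinslerIsometry {F : TangentBundle 𝓘(ℝ, E) M → ℝ}
    {F' : TangentBundle 𝓘(ℝ, E') N → ℝ} {φ : M → N} (h : IsFinslerIsometry F F' φ) :
    IsLocalFinslerIsometry F F' φ := by
  obtain ⟨⟨Φ, rfl⟩, h⟩ := h
  exact fun p => ⟨Φ.toPartialDiffeomorph, Set.mem_univ p, fun _ _ => rfl, fun v _ => h v⟩

lemma IsLocalFinslerIsometry.isLocalDiffeomorph {F : TangentBundle 𝓘(ℝ, E) M → ℝ}
    {F' : TangentBundle 𝓘(ℝ, E') N → ℝ} {φ : M → N} (h : IsLocalFinslerIsometry F F' φ) :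
    IsLocalDiffeomorph 𝓘(ℝ, E) 𝓘(ℝ, E') ∞ φ := fun p =>
  let ⟨Φ, hp, he, _⟩ := h p
  ⟨Φ, hp, he⟩

end Maps

/-! ### Canonical sprays: behaviour under isometries, existence, geodesics. -/

section Sprays

variable {E : Type*} [NormedAddCommGroup E] [NormedSpace ℝ E]
  {M : Type*} [TopologicalSpace M] [ChartedSpace E M] [IsManifold 𝓘(ℝ, E) ∞ M]
  {E' : Type*} [NormedAddCommGroup E'] [NormedSpace ℝ E']
  {N : Type*} [TopologicalSpace N] [ChartedSpace E' N] [IsManifold 𝓘(ℝ, E') ∞ N]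

lemma tangentChart_dilation (v : TangentBundle 𝓘(ℝ, E) M) (t : ℝ) :
    tangentChart v (dilation t v) = ((tangentChart v v).1, t • (tangentChart v v).2) := by
  rw [tangentChart_self]
  exact tangentChart_fiberIncl v (t • v.2)

/-- The derivative of a dilation, in the coordinates of the preferred charts. -/
lemma mfderiv_dilation (t : ℝ) (v : TangentBundle 𝓘(ℝ, E) M) (ξ : E × E) :
    mfderiv 𝓘(ℝ, E).tangent 𝓘(ℝ, E).tangent (dilation (M := M) t) v ξ = (ξ.1, t • ξ.2) := by
  let m : E × E →L[ℝ] E × E :=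
    (ContinuousLinearMap.fst ℝ E E).prod (t • ContinuousLinearMap.snd ℝ E E)
  have hm : ∀ z ∈ (tangentChart v).target,
      dilation t ((tangentChart v).symm z) = (tangentChart v).symm (m z) := fun z hz =>
    (tangentChart_symm_dilation v (mem_tangentChart_target.1 hz) t).symm
  have hsrc : (tangentChart v).source ∈ 𝓝 v := extChartAt_source_mem_nhds v
  have hd : MDifferentiableAt 𝓘(ℝ, E).tangent 𝓘(ℝ, E).tangent (dilation (M := M) t) v := by
    have h1 : ContMDiffAt 𝓘(ℝ, E).tangent 𝓘(ℝ, E × E) ∞ (tangentChart v) v :=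
      (contMDiffOn_tangentChart v).contMDiffAt hsrc
    have h2 : ContMDiffAt 𝓘(ℝ, E × E) 𝓘(ℝ, E × E) ∞ m (tangentChart v v) :=
      m.contMDiff.contMDiffAt
    have h3 := contMDiffAt_tangentChart_symm v (z := m (tangentChart v v)) (chartAt_mem_target v)
    refine MDifferentiableAt.congr_of_eventuallyEq
      ((h3.comp v (h2.comp v h1)).mdifferentiableAt (by simp)) ?_
    filter_upwards [hsrc] with w hw
    refine Eq.trans ?_ (hm _ ((tangentChart v).map_source hw))
    rw [(tangentChart v).left_inv hw]
  rw [mfderiv_eq_fderiv_writtenInExtChartAt hd]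
  have h : writtenInExtChartAt 𝓘(ℝ, E).tangent 𝓘(ℝ, E).tangent v (dilation (M := M) t)
      =ᶠ[𝓝 (tangentChart v v)] m := by
    filter_upwards [eventually_mem_target (chartAt_mem_target v)] with z hz
    change tangentChart v (dilation t ((tangentChart v).symm z)) = m z
    rw [hm z (mem_tangentChart_target.2 hz), (tangentChart v).right_inv]
    exact mem_tangentChart_target.2 hz
  rw [h.fderiv_eq, m.fderiv]
  rfl

/-- Sprays vanish on zero vectors. -/
lemma IsSpray.eq_zero {S : ∀ v : TangentBundle 𝓘(ℝ, E) M, TangentSpace 𝓘(ℝ, E).tangent v}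
    (hS : IsSpray S) {v : TangentBundle 𝓘(ℝ, E) M} (hv : v ∉ slit E M) : S v = 0 := by
  have h0 : v.2 = 0 := not_not.1 hv
  let S₁ : TangentBundle 𝓘(ℝ, E) M → E × E := S
  have h1 : (S₁ v).1 = 0 := ((vertEndo_eq_liouville_iff v (S₁ v)).1 (hS.vertEndo_eq v)).trans h0
  -- Any factor other than 1 would do: a zero vector is fixed, while the vertical part of the spray
  -- is multiplied by the square of the factor.
  have h2 : dilation 2 v = v := by
    obtain ⟨p, y⟩ := v
    change y = 0 at h0
    simp [dilation, h0]
  have h3 : S₁ (dilation 2 v) = (2 : ℝ) • ((S₁ v).1, (2 : ℝ) • (S₁ v).2) :=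
    (hS.homogeneous 2 v two_pos).trans
      (congrArg (fun ξ : E × E => (2 : ℝ) • ξ) (mfderiv_dilation 2 v (S₁ v)))
  rw [h2, h1] at h3
  have h4 : (S₁ v).2 = (4 : ℝ) • (S₁ v).2 := by
    have := congrArg Prod.snd h3
    simp only [Prod.smul_snd, smul_smul] at this
    norm_num at this
    exact this
  have h5 : (3 : ℝ) • (S₁ v).2 = 0 := by
    have : (3 : ℝ) • (S₁ v).2 = (4 : ℝ) • (S₁ v).2 - (S₁ v).2 := by module
    rw [this, ← h4, sub_self]
  exact Prod.ext h1 ((smul_eq_zero.1 h5).resolve_left (by norm_num))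

lemma IsCanonicalSpray.isSprayVector {F : TangentBundle 𝓘(ℝ, E) M → ℝ}
    (hF : IsFinslerFunction F)
    {S : ∀ v : TangentBundle 𝓘(ℝ, E) M, TangentSpace 𝓘(ℝ, E).tangent v}
    (hS : IsCanonicalSpray F S) {v : TangentBundle 𝓘(ℝ, E) M} (hv : v ∈ slit E M) :
    IsSprayVector (chartEnergy F v) (tangentChart v v) (S v) :=
  (hF.isSprayVector_iff_canonical hv (S v)).2 ⟨hS.isSpray.vertEndo_eq v, hS.eq v hv⟩

lemma IsFinslerFunction.isSprayVector_iff_eq [FiniteDimensional ℝ E]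
    {F : TangentBundle 𝓘(ℝ, E) M → ℝ}
    (hF : IsFinslerFunction F) {v : TangentBundle 𝓘(ℝ, E) M} (hv : v ∈ slit E M) (ξ : E × E) :
    IsSprayVector (chartEnergy F v) (tangentChart v v) ξ ↔
      ξ = sprayModel (chartEnergy F v) (tangentChart v v) :=
  isSprayVector_iff_eq_sprayModel
    (hF.contDiffAt_chartEnergy_tangentChart (mem_chart_source E v.1) hv)
    (hF.homogeneousNear_chartEnergy v (chartAt_mem_target v)) (hF.isInvertible_vertHess hv) ξ

/-- Isometric local diffeomorphisms relate the canonical sprays. -/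
theorem IsCanonicalSpray.mfderiv_tangentMap_eq [FiniteDimensional ℝ E']
    {F : TangentBundle 𝓘(ℝ, E) M → ℝ} {F' : TangentBundle 𝓘(ℝ, E') N → ℝ}
    (hF : IsFinslerFunction F) (hF' : IsFinslerFunction F') {φ : M → N}
    (hφ : ContMDiff 𝓘(ℝ, E) 𝓘(ℝ, E') ∞ φ)
    (hbij : ∀ p, Function.Bijective (mfderiv 𝓘(ℝ, E) 𝓘(ℝ, E') φ p))
    (hiso : ∀ v, F' (tangentMap 𝓘(ℝ, E) 𝓘(ℝ, E') φ v) = F v)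
    {S : ∀ v : TangentBundle 𝓘(ℝ, E) M, TangentSpace 𝓘(ℝ, E).tangent v}
    {S' : ∀ v : TangentBundle 𝓘(ℝ, E') N, TangentSpace 𝓘(ℝ, E').tangent v}
    (hS : IsCanonicalSpray F S) (hS' : IsCanonicalSpray F' S')
    (v : TangentBundle 𝓘(ℝ, E) M) :
    mfderiv 𝓘(ℝ, E).tangent 𝓘(ℝ, E').tangent (tangentMap 𝓘(ℝ, E) 𝓘(ℝ, E') φ) v (S v)
      = S' (tangentMap 𝓘(ℝ, E) 𝓘(ℝ, E') φ v) := by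
  -- Injectivity of the derivative keeps nonzero vectors nonzero, so the two sprays are compared
  -- either by uniqueness or at zero vectors.
  have hiff : tangentMap 𝓘(ℝ, E) 𝓘(ℝ, E') φ v ∈ slit E' N ↔ v ∈ slit E M :=
    not_congr (map_eq_zero_iff (mfderiv 𝓘(ℝ, E) 𝓘(ℝ, E') φ v.1) (hbij v.1).1)
  by_cases hv : v ∈ slit E M
  · have hv' := hiff.2 hv
    have h1 := (hS.isSprayVector hF hv).map_tangentMap hF' hφ hiso
      (v' := tangentMap 𝓘(ℝ, E) 𝓘(ℝ, E') φ v) (hbij v.1).2 (mem_chart_source E v.1)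
      (mem_chart_source E' (φ v.1)) hv'
    rw [mfderiv_tangentMap hφ]
    -- Both sides solve the spray equation of `F'` at the same vector, and the solution is unique.
    exact ((hF'.isSprayVector_iff_eq hv' _).1 h1).trans
      ((hF'.isSprayVector_iff_eq hv' _).1 (hS'.isSprayVector hF' hv')).symm
  · rw [hS.isSpray.eq_zero hv, hS'.isSpray.eq_zero (mt hiff.1 hv)]
    exact map_zero _

/-! ### Existence of the canonical spray. -/

section Existence

variable [FiniteDimensional ℝ E]

open Classical in
/-- The canonical spray of `F`. -/
def canonicalSpray (F : TangentBundle 𝓘(ℝ, E) M → ℝ) (v : TangentBundle 𝓘(ℝ, E) M) : E × E :=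
  if v ∈ slit E M then sprayModel (chartEnergy F v) (tangentChart v v) else 0

variable {F : TangentBundle 𝓘(ℝ, E) M → ℝ}

lemma IsFinslerFunction.isSprayVector_canonicalSpray (hF : IsFinslerFunction F)
    {v : TangentBundle 𝓘(ℝ, E) M} (hv : v ∈ slit E M) :
    IsSprayVector (chartEnergy F v) (tangentChart v v) (canonicalSpray F v) :=
  (hF.isSprayVector_iff_eq hv _).2 (if_pos hv)

/-- The canonical spray in the chart at `v`, at a nearby vector `w`. -/
lemma IsFinslerFunction.canonicalSpray_in_chart (hF : IsFinslerFunction F)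
    {v w : TangentBundle 𝓘(ℝ, E) M} (hw : w.1 ∈ (chartAt E v.1).source) (hws : w ∈ slit E M)
    (hinv : (vertHess (chartEnergy F v) (tangentChart v w)).IsInvertible) :
    fderiv ℝ (tangentModel (chartRep (id : M → M) w.1 v.1)) (tangentChart w w)
      (canonicalSpray F w) = sprayModel (chartEnergy F v) (tangentChart v w) := by
  -- Naturality for the identity map, read in the charts at `w` and at `v`, is invariance of the
  -- spray equation under change of coordinates.
  have h1 := (hF.isSprayVector_canonicalSpray hws).map_tangentMap (φ := (id : M → M)) (v' := v) hF
    contMDiff_id (fun u => by rw [tangentMap_id]; rfl)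
    (by rw [mfderiv_id]; exact Function.surjective_id) (mem_chart_source E w.1) hw
    (by rw [tangentMap_id]; exact hws)
  rw [tangentMap_id] at h1
  exact (isSprayVector_iff_eq_sprayModel (hF.contDiffAt_chartEnergy_tangentChart hw hws)
    (hF.homogeneousNear_chartEnergy v (tangentChart_fst_mem_target hw)) hinv _).1 h1

/-- The definition uses a chart that varies with the point. Trivialising over the fixed chart at `v`
turns the section near `v` into `sprayModel`, which is smooth because inversion of the Hessian is.
-/
lemma IsFinslerFunction.contMDiffOn_canonicalSpray (hF : IsFinslerFunction F) :
    ContMDiffOn 𝓘(ℝ, E).tangent 𝓘(ℝ, E).tangent.tangent ∞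
      (fun v => (⟨v, canonicalSpray F v⟩ :
        TangentBundle 𝓘(ℝ, E).tangent (TangentBundle 𝓘(ℝ, E) M))) (slit E M) := by
  intro v hv
  refine ContMDiffAt.contMDiffWithinAt ?_
  refine (Bundle.contMDiffAt_section (IB := 𝓘(ℝ, E).tangent) (F := E × E)
    (E := fun w : TangentBundle 𝓘(ℝ, E) M => TangentSpace 𝓘(ℝ, E).tangent w)
    (s := fun w => canonicalSpray F w) v).2 ?_
  have hL := hF.contDiffAt_chartEnergy_tangentChart (mem_chart_source E v.1) hv
  have hinv := hF.isInvertible_vertHess hv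
  have hsrc : (tangentChart v).source ∈ 𝓝 v := extChartAt_source_mem_nhds v
  have h1 : ContMDiffAt 𝓘(ℝ, E).tangent 𝓘(ℝ, E × E) ∞ (tangentChart v) v :=
    (contMDiffOn_tangentChart v).contMDiffAt hsrc
  have h2 : ContMDiffAt 𝓘(ℝ, E).tangent 𝓘(ℝ, E × E) ∞
      (fun w => sprayModel (chartEnergy F v) (tangentChart v w)) v :=
    (contDiffAt_sprayModel hL hinv).contMDiffAt.comp v h1
  refine h2.congr_of_eventuallyEq ?_
  filter_upwards [hsrc, isOpen_slit.mem_nhds hv,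
    h1.continuousAt.eventually (eventually_isInvertible_vertHess hL hinv)] with w hw hws hwi
  have hw1 := mem_tangentChart_source.1 hw
  rw [← hF.canonicalSpray_in_chart hw1 hws hwi, TangentBundle.trivializationAt_apply]
  have h3 : tangentChart v ∘ (tangentChart w).symm =ᶠ[𝓝 (tangentChart w w)]
      tangentModel (chartRep (id : M → M) w.1 v.1) := by
    have := eventually_tangentChart_tangentMap (φ := (id : M → M)) contMDiff_id (v := w)
      (v' := v) (z := tangentChart w w) (chartAt_mem_target w)
      (by rw [tangentChart_self, (chartAt E w.1).left_inv (mem_chart_source E w.1)]; exact hw1)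
    rw [tangentMap_id] at this
    exact this
  rw [← h3.fderiv_eq, ModelWithCorners.range_eq_univ, fderivWithin_univ]
  rfl

/-- Every Finsler function has a canonical spray. -/
theorem IsFinslerFunction.isCanonicalSpray_canonicalSpray (hF : IsFinslerFunction F) :
    IsCanonicalSpray F (fun v => canonicalSpray F v) where
  isSpray :=
    { smooth := hF.contMDiffOn_canonicalSpray
      homogeneous := by
        intro t v ht
        refine Eq.trans ?_ (congrArg (fun ξ : E × E => t • ξ)
          (mfderiv_dilation t v (canonicalSpray F v))).symm
        have hiff : dilation t v ∈ slit E M ↔ v ∈ slit E M :=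
          not_congr (smul_eq_zero_iff_right ht.ne')
        by_cases hv : v ∈ slit E M
        · have hvt := hiff.2 hv
          have h1 := hF.contDiffAt_chartEnergy_tangentChart (v := v) (mem_chart_source E v.1) hv
          have h2 := hF.contDiffAt_chartEnergy_tangentChart (v := v) (w := dilation t v)
            (mem_chart_source E v.1) hvt
          have h3 := (hF.isSprayVector_canonicalSpray hv).dilation ht h1
            (by rwa [tangentChart_dilation] at h2)
            (hF.homogeneousNear_chartEnergy v (chartAt_mem_target v))
          rw [← tangentChart_dilation] at h3
          -- The preferred chart depends only on the base point, so `v` and `dilation t v` share the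
          -- same chart energy and uniqueness applies.
          exact ((hF.isSprayVector_iff_eq hvt _).1 (hF.isSprayVector_canonicalSpray hvt)).trans
            ((hF.isSprayVector_iff_eq hvt _).1 h3).symm
        · rw [canonicalSpray, if_neg (mt hiff.1 hv), canonicalSpray, if_neg hv]
          change (0 : E × E) = t • ((0 : E), t • (0 : E))
          rw [smul_zero, Prod.mk_zero_zero, smul_zero]
      vertEndo_eq := by
        intro v
        by_cases hv : v ∈ slit E M
        · exact ((hF.isSprayVector_iff_canonical hv _).1 (hF.isSprayVector_canonicalSpray hv)).1
        · refine (vertEndo_eq_liouville_iff v _).2 ?_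
          rw [canonicalSpray, if_neg hv]
          exact (not_not.1 hv).symm }
  eq v hv :=
    ((hF.isSprayVector_iff_canonical hv _).1 (hF.isSprayVector_canonicalSpray hv)).2

end Existence

/-- Smooth maps relating two sprays map geodesics to geodesics. -/
theorem IsSprayGeodesic.comp {φ : M → N} (hφ : ContMDiff 𝓘(ℝ, E) 𝓘(ℝ, E') ∞ φ)
    {S : ∀ v : TangentBundle 𝓘(ℝ, E) M, TangentSpace 𝓘(ℝ, E).tangent v}
    {S' : ∀ v : TangentBundle 𝓘(ℝ, E') N, TangentSpace 𝓘(ℝ, E').tangent v}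
    (hSS' : ∀ v : TangentBundle 𝓘(ℝ, E) M,
      mfderiv 𝓘(ℝ, E).tangent 𝓘(ℝ, E').tangent (tangentMap 𝓘(ℝ, E) 𝓘(ℝ, E') φ) v (S v)
        = S' (tangentMap 𝓘(ℝ, E) 𝓘(ℝ, E') φ v))
    {γ : ℝ → M} {s : Set ℝ} (hs : UniqueDiffOn ℝ s) (hγ : IsSprayGeodesic S γ s) :
    IsSprayGeodesic S' (φ ∘ γ) s := by
  refine ⟨hφ.comp_contMDiffOn hγ.1, fun t ht => ?_⟩
  have hd : ContMDiff 𝓘(ℝ, E).tangent 𝓘(ℝ, E').tangent ∞ (tangentMap 𝓘(ℝ, E) 𝓘(ℝ, E') φ) :=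
    hφ.contMDiff_tangentMap (by simp)
  have h1 := HasMFDerivAt.comp_hasMFDerivWithinAt t
    (hd.mdifferentiableAt (x := velocity γ s t) (by simp)).hasMFDerivAt (hγ.2 t ht)
  have h2 := h1.congr_of_eventuallyEq
    (Filter.eventually_of_mem self_mem_nhdsWithin fun t' ht' => velocity_comp hφ hs hγ.1 ht')
    (velocity_comp hφ hs hγ.1 ht)
  rw [velocity_comp hφ hs hγ.1 ht, ← hSS']
  refine h2.congr_mfderiv ?_
  refine ContinuousLinearMap.ext fun (r : ℝ) => ?_
  exact map_smul (mfderiv 𝓘(ℝ, E).tangent 𝓘(ℝ, E').tangent (tangentMap 𝓘(ℝ, E) 𝓘(ℝ, E') φ)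
    (velocity γ s t)) r (S (velocity γ s t))

end Sprays

end FinslerGeometry

end

open FinslerGeometry in
theorem proposition3p2
    {E : Type*} [NormedAddCommGroup E] [NormedSpace ℝ E] [FiniteDimensional ℝ E]
    {M : Type*} [TopologicalSpace M] [ChartedSpace E M] [IsManifold 𝓘(ℝ, E) ∞ M]
    [T2Space M] [SecondCountableTopology M] [ConnectedSpace M]
    {E' : Type*} [NormedAddCommGroup E'] [NormedSpace ℝ E'] [FiniteDimensional ℝ E']
    {N : Type*} [TopologicalSpace N] [ChartedSpace E' N] [IsManifold 𝓘(ℝ, E') ∞ N]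
    [T2Space N] [SecondCountableTopology N] [ConnectedSpace N]
    (F : TangentBundle 𝓘(ℝ, E) M → ℝ) (hF : IsFinslerFunction F)
    (F' : TangentBundle 𝓘(ℝ, E') N → ℝ) (hF' : IsFinslerFunction F')
    (φ : M → N) (hφ : IsFinslerIsometry F F' φ ∨ IsLocalFinslerIsometry F F' φ) :
    (∀ (s : Set ℝ) (γ : ℝ → M), s.OrdConnected → s.Nontrivial →
      IsFinslerGeodesic F γ s → IsFinslerGeodesic F' (φ ∘ γ) s) ∧
    (∀ S S', IsCanonicalSpray F S → IsCanonicalSpray F' S' →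
      ∀ v : TangentBundle 𝓘(ℝ, E) M,
        mfderiv 𝓘(ℝ, E).tangent 𝓘(ℝ, E').tangent (tangentMap 𝓘(ℝ, E) 𝓘(ℝ, E') φ) v (S v)
          = S' (tangentMap 𝓘(ℝ, E) 𝓘(ℝ, E') φ v)) := by
  have hloc : IsLocalFinslerIsometry F F' φ := hφ.elim (·.isLocalFinslerIsometry) id
  have hdiff := hloc.isLocalDiffeomorph
  have hsmooth : ContMDiff 𝓘(ℝ, E) 𝓘(ℝ, E') ∞ φ := hdiff.contMDiff
  have hbij : ∀ p, Function.Bijective (mfderiv 𝓘(ℝ, E) 𝓘(ℝ, E') φ p) := fun p =>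
    ((hdiff p).mfderivToContinuousLinearEquiv (by simp)).bijective
  have hiso : ∀ v, F' (tangentMap 𝓘(ℝ, E) 𝓘(ℝ, E') φ v) = F v := fun v =>
    let ⟨_, hp, _, h⟩ := hloc v.1
    h v hp
  have hrel : ∀ S S', IsCanonicalSpray F S → IsCanonicalSpray F' S' →
      ∀ v : TangentBundle 𝓘(ℝ, E) M,
        mfderiv 𝓘(ℝ, E).tangent 𝓘(ℝ, E').tangent (tangentMap 𝓘(ℝ, E) 𝓘(ℝ, E') φ) v (S v)
          = S' (tangentMap 𝓘(ℝ, E) 𝓘(ℝ, E') φ v) := fun S S' hS hS' =>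
    hS.mfderiv_tangentMap_eq hF hF' hsmooth hbij hiso hS'
  refine ⟨fun s γ hs hs' ⟨S, hS, hγ⟩ => ?_, hrel⟩
  have hS' := hF'.isCanonicalSpray_canonicalSpray
  have hconv : Convex ℝ s := convex_iff_ordConnected.2 hs
  -- A nondegenerate interval is convex with nonempty interior, hence a set of unique
  -- differentiability.
  exact ⟨_, hS', hγ.comp hsmooth (hrel _ _ hS hS')
    (uniqueDiffOn_convex hconv (hconv.nontrivial_iff_nonempty_interior.1 hs'))⟩
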